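/- For a probability law $\mathbf p=(p_0,p_1,\dots)$ on $\{0,1,2,\dots\}$ consider the Galton–Watson tree with offspring law $\mathbf p$, edges directed from parents to children, and a token that starts at the root and is moved along edges by two players alternately; both players know the tree. In the normal game a player who cannot move loses; let $N$ and $P$ be the probabilities that the first, respectively the second, player has a winning strategy, and let $D=D(\mathbf p)=1-N-P$ be the probability of a draw. In the escape game the player Stopper wins if ever a player is unable to move, and otherwise the player Escaper wins; let $E^{(1)}=E^{(1)}(\mathbf p)$ be the probability that Stopper has no winning strategy when Escaper moves first. For each of (i)–(iii) below there exists a family $(\mathbf p(t):t\in(0,1))$ of laws on $\{0,1,2,\dots\}$, continuous in the metric $\sum_k|p_k-q_k|$ and of uniformly bounded support, with the stated properties, where $D$ and $E^{(1)}$ are regarded as functions of $t\in(0,1)$. (i) The normal game has a (non-trivial) discontinuous phase transition: there is $t^*\in(0,1)$ such that $D=0$ for $t<t^*$, while $D\in(0,1)$ for $t\ge t^*$, and $p_1(t^*)<1$. (ii) The normal game has two phase transitions: there are $0<t^-<t^+<1$ such that $D=0$ for $t\le t^-$, $D$ is continuous on $(0,t^+)$ and strictly increasing on $[t^-,t^+)$,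 and at $t^+$ it jumps from one positive value to another, both less than $1$: $\lim_{t\uparrow t^+}D(t)=a$ and $\lim_{t\downarrow t^+}D(t)=D(t^+)=b$ with $0<a<b<1$. (iii) The escape game has a continuous phase transition: there is $t_e\in(0,1)$ such that $E^{(1)}=0$ for $t\le t_e$, while $E^{(1)}\in(0,1)$ for $t>t_e$, and $E^{(1)}$ is a continuous function of $t\in(0,1)$. -/

import Mathlib

open Filter Topology MeasureTheory Set

noncomputable section

namespace GWGame

section Games

variable {V : Type*}

/-- The position `v` has at least one legal move. -/
def HasMove (G : Digraph V) (v : V) : Prop := ∃ w, G.Adj v w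

/-- A strategy assigns to every vertex a legal move, where one exists (the value at a vertex
without moves is irrelevant). -/
def IsStrategy (G : Digraph V) (σ : V → V) : Prop := ∀ v, HasMove G v → G.Adj v (σ v)

/-- The position after `n` moves from `v` when the first player uses `σ` and the second player
uses `τ`; it is meaningful as long as no vertex without moves has been met before. -/
def play (σ τ : V → V) (v : V) : ℕ → V
  | 0 => v
  | n + 1 => if Even n then σ (play σ τ v n) else τ (play σ τ v n)

/-- The game started at `v` ends after exactly `n` moves, since the player who should make move
number `n + 1` (the first player for even `n`, the second player for odd `n`) cannot move. -/
def EndsAfter (G : Digraph V) (σ τ : V → V) (v : V) (n : ℕ) : Prop :=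
  ¬ HasMove G (play σ τ v n) ∧ ∀ m < n, HasMove G (play σ τ v m)

/-- Normal game from `v`: the player who moves first has a winning strategy. -/
def NextWins (G : Digraph V) (v : V) : Prop :=
  ∃ σ, IsStrategy G σ ∧ ∀ τ, IsStrategy G τ → ∃ n, Odd n ∧ EndsAfter G σ τ v n

/-- Normal game from `v`: the player who moves second has a winning strategy. -/
def PreviousWins (G : Digraph V) (v : V) : Prop :=
  ∃ τ, IsStrategy G τ ∧ ∀ σ, IsStrategy G σ → ∃ n, Even n ∧ EndsAfter G σ τ v n

/-- Escape game from `v` in which Escaper moves first and Stopper second: Stopper has a winning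
strategy, that is, a strategy that forces the game to end. -/
def StopperWinsSecond (G : Digraph V) (v : V) : Prop :=
  ∃ τ, IsStrategy G τ ∧ ∀ σ, IsStrategy G σ → ∃ n, EndsAfter G σ τ v n

end Games

/-- The family tree in Ulam-Harris notation: individuals are finite words, the root is the empty
word, and the individual `v`, who has `ω v` children, is the parent of `v ++ [i]` for `i < ω v`.
The tree consists of the words that are reachable from the root; words that are not reachable
play no role in a game started at the root. -/
def familyTree (ω : List ℕ → ℕ) : Digraph (List ℕ) where
  Adj v w := ∃ i < ω v, w = v ++ [i]

/-- The law of the numbers of children: they are independent, each with law `p`. -/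
def galtonWatson (p : PMF ℕ) : Measure (List ℕ → ℕ) :=
  Measure.infinitePi fun _ : List ℕ => p.toMeasure

/-- The probability `N` that the normal game is a win for the first player. -/
def probN (p : PMF ℕ) : ℝ := (galtonWatson p).real {ω | NextWins (familyTree ω) []}

/-- The probability `P` that the normal game is a win for the second player. -/
def probP (p : PMF ℕ) : ℝ := (galtonWatson p).real {ω | PreviousWins (familyTree ω) []}

/-- The probability `D` that the normal game is a draw. -/
def probD (p : PMF ℕ) : ℝ := 1 - probN p - probP p

/-- The probability `S⁽²⁾` that Stopper wins the escape game when moving second. -/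
def probS2 (p : PMF ℕ) : ℝ := (galtonWatson p).real {ω | StopperWinsSecond (familyTree ω) []}

/-- The probability `E⁽¹⁾` that Escaper wins the escape game when moving first. -/
def probE1 (p : PMF ℕ) : ℝ := 1 - probS2 p

/-- The `ℓ¹` distance between two offspring laws (the sum always converges). -/
def l1Dist (p q : PMF ℕ) : ℝ := ∑' k, |(p k).toReal - (q k).toReal|

/-- `(p t : t ∈ (0,1))` is a continuous family of offspring laws, with respect to the `ℓ¹`
distance. Only the values for `t` in the open interval `(0,1)` matter. -/
def ContinuousFamily (p : ℝ → PMF ℕ) : Prop :=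
  ∀ t ∈ Ioo (0 : ℝ) 1, Tendsto (fun s => l1Dist (p s) (p t)) (𝓝 t) (𝓝 0)

/-- The laws `p t`, `t ∈ (0,1)`, have uniformly bounded support. -/
def UniformlyBoundedSupport (p : ℝ → PMF ℕ) : Prop :=
  ∃ K : ℕ, ∀ t ∈ Ioo (0 : ℝ) 1, ∀ k, K < k → p t k = 0

end GWGame

end

/-!
A game on a Galton–Watson tree is decided within a bounded number of rounds if it is decided at all,
because the tree is locally finite. The probabilities of a decision within `n` rounds obey a
recursion in the generating function `G` of the offspring law, since the subtrees at the children of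
the root are independent copies of the tree. In the limit, `N` is the least fixed point of the
twofold iterate of `x ↦ 1 - G x`, and `1 - P = 1 - G N` is the other point of its two-cycle; `D` is
the distance of the two points. Likewise `E⁽¹⁾` is the greatest fixed point of
`y ↦ 1 - G (p₀ + 1 - G y)`.

All families used here have the form `(1 - t) δ₀ + t q` with `q` a law on the positive integers. For
the normal game one then has to study the two-cycles `(x, y)` of `F t x = t * (1 - Q x)`, where `Q`
is the generating function of `q`. They are the solutions of `Φ x y = 1` and `t * Ψ x y = 1`, where
`Φ` and `Ψ` are the divided differences of `x * Q x` and of `Q`. These two equations make sense on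
the diagonal too, where they describe a fixed point with multiplier `-1`, and they are preserved
under limits. The key fact is that the points of a two-cycle move outwards when `t` grows
(`IsCycle.push`), so `D` increases strictly once a cycle exists and is right-continuous there.

* If a proper cycle exists before the fixed point has multiplier `-1`, the first cycle cannot be
  degenerate, and `D` jumps from `0` to a positive value (`discontinuous_transition`). This happens
  for the weights `1/5`, `1/2`, `3/10` on `1`, `2`, `7`.
* For the weights `1/5`, `1/5`, `3/5` the curve of cycles that starts at the degenerate cycle is at
  first parametrised monotonically by `t`, so `D` grows continuously from `0`. Before this curve
  turns back, a more distant pair of points becomes a cycle, and there `D` jumps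
  (`continuous_then_jump`).
  Monotonicity is a statement about `Ψ - lam * Φ` on a small box in the coordinates of midpoint and
  squared distance. That no distant cycle exists too early is seen by iterating the map from `0` past
  the bottleneck at the future jump, in integer arithmetic with controlled rounding.
* For the escape game with weights `3/4` and `1/4` on `1` and `3`, a positive solution of the
  recursion satisfies an equation whose left-hand side is convex, and this yields uniqueness of the
  solution under a closed complementarity condition; continuity follows by compactness.
-/

noncomputable section

namespace GWGame

/-! ### Winning within a bounded number of rounds -/

section Levels

variable {V : Type*}

/-- The opponent of the attacker is about to move from `v`, and within `n` rounds the attacker can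
force the game to end when the opponent should move or, if `b` holds, at anybody's turn. With `b`
false this is a loss for the player to move in the normal game; with `b` true the attacker is
Stopper in the escape game. -/
def DefenderLoses (G : Digraph V) (b : Prop) : ℕ → V → Prop
  | 0, _ => False
  | n + 1, v => ∀ w, G.Adj v w →
      (b ∧ ¬ HasMove G w) ∨ ∃ x, G.Adj w x ∧ DefenderLoses G b n x

/-- As `DefenderLoses`, but the attacker is about to move from `v`. -/
def AttackerWins (G : Digraph V) (b : Prop) (n : ℕ) (v : V) : Prop :=
  (b ∧ ¬ HasMove G v) ∨ ∃ w, G.Adj v w ∧ DefenderLoses G b n w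

variable {G : Digraph V} {b : Prop}

lemma defenderLoses_succ {n : ℕ} {v : V} :
    DefenderLoses G b (n + 1) v ↔ ∀ w, G.Adj v w → AttackerWins G b n w := Iff.rfl

lemma DefenderLoses.succ {n : ℕ} {v : V} (h : DefenderLoses G b n v) :
    DefenderLoses G b (n + 1) v := by
  induction n generalizing v with
  | zero => exact h.elim
  | succ n ih =>
    intro w hw
    rcases h w hw with h | ⟨x, hx, h⟩
    · exact Or.inl h
    · exact Or.inr ⟨x, hx, ih h⟩

lemma DefenderLoses.mono {n m : ℕ} {v : V} (h : DefenderLoses G b n v) (hnm : n ≤ m) :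
    DefenderLoses G b m v :=
  Nat.le_induction h (fun _ _ => DefenderLoses.succ) m hnm

lemma AttackerWins.mono {n m : ℕ} {v : V} (h : AttackerWins G b n v) (hnm : n ≤ m) :
    AttackerWins G b m v :=
  h.imp_right fun ⟨w, hw, h⟩ => ⟨w, hw, h.mono hnm⟩

lemma play_succ (σ τ : V → V) (v : V) (n : ℕ) : play σ τ v (n + 1) = play τ σ (σ v) n := by
  induction n with
  | zero => simp [play]
  | succ n ih =>
    rw [play, ih, play]
    simp only [Nat.even_add_one]
    split_ifs <;> simp_all

lemma endsAfter_zero {σ τ : V → V} {v : V} : EndsAfter G σ τ v 0 ↔ ¬ HasMove G v := by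
  simp [EndsAfter, play]

lemma endsAfter_succ {σ τ : V → V} {v : V} {n : ℕ} :
    EndsAfter G σ τ v (n + 1) ↔ HasMove G v ∧ EndsAfter G τ σ (σ v) n := by
  simp only [EndsAfter, play_succ, Nat.forall_lt_succ_left]
  simp only [play]
  tauto

open Classical in
/-- A strategy that moves along an edge to a position with the property `Q` wherever it can. -/
def preferring (G : Digraph V) (Q : V → V → Prop) (v : V) : V :=
  if h : ∃ w, G.Adj v w ∧ Q v w then h.choose
  else if h : HasMove G v then h.choose else v

lemma preferring_isStrategy (Q : V → V → Prop) : IsStrategy G (preferring G Q) := by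
  intro v hv
  unfold preferring
  split_ifs with h
  · exact h.choose_spec.1
  · exact hv.choose_spec

lemma preferring_spec {Q : V → V → Prop} {v : V} (h : ∃ w, G.Adj v w ∧ Q v w) :
    Q v (preferring G Q v) := by
  unfold preferring
  rw [dif_pos h]
  exact h.choose_spec.2

/-- The winning strategy of the attacker moves to a position at which the opponent loses within as
few rounds as possible. -/
def attack (G : Digraph V) (b : Prop) : V → V :=
  preferring G fun v w => ∀ n x, G.Adj v x → DefenderLoses G b n x → DefenderLoses G b n w

lemma attack_spec {n : ℕ} {v w : V} (hw : G.Adj v w) (h : DefenderLoses G b n w) :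
    DefenderLoses G b n (attack G b v) := by
  classical
  have hex : ∃ n w, G.Adj v w ∧ DefenderLoses G b n w := ⟨n, w, hw, h⟩
  obtain ⟨x, hx, hxl⟩ := Nat.find_spec hex
  refine preferring_spec (Q := fun v w => ∀ n x, G.Adj v x → DefenderLoses G b n x →
    DefenderLoses G b n w) ⟨x, hx, fun m y hy hm => ?_⟩ n w hw h
  exact hxl.mono (Nat.find_min' hex ⟨y, hy, hm⟩)

lemma attack_wins (n : ℕ) (v : V) (σ : V → V) (hσ : IsStrategy G σ) :
    (DefenderLoses G b n v → ∃ k, (Even k ∨ b) ∧ EndsAfter G σ (attack G b) v k) ∧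
    (AttackerWins G b n v → ∃ k, (Odd k ∨ b) ∧ EndsAfter G (attack G b) σ v k) := by
  have key : ∀ n, (∀ v, DefenderLoses G b n v →
      ∃ k, (Even k ∨ b) ∧ EndsAfter G σ (attack G b) v k) → ∀ v, AttackerWins G b n v →
      ∃ k, (Odd k ∨ b) ∧ EndsAfter G (attack G b) σ v k := by
    rintro n ih v (⟨hb, hv⟩ | ⟨w, hw, h⟩)
    · exact ⟨0, Or.inr hb, endsAfter_zero.2 hv⟩
    · obtain ⟨k, hk, he⟩ := ih _ (attack_spec hw h)
      exact ⟨k + 1, hk.imp_left Even.add_one, endsAfter_succ.2 ⟨⟨w, hw⟩, he⟩⟩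
  have main : ∀ v, DefenderLoses G b n v →
      ∃ k, (Even k ∨ b) ∧ EndsAfter G σ (attack G b) v k := by
    induction n with
    | zero => exact fun v h => h.elim
    | succ n ih =>
      intro v h
      by_cases hv : HasMove G v
      · obtain ⟨k, hk, he⟩ := key n ih _ (h _ (hσ v hv))
        exact ⟨k + 1, hk.imp_left Odd.add_one, endsAfter_succ.2 ⟨hv, he⟩⟩
      · exact ⟨0, Or.inl Even.zero, endsAfter_zero.2 hv⟩
  exact ⟨main v, key n main v⟩

/-- The strategy of the defender that never leaves the positions from which the attacker cannot win
within a bounded number of rounds. -/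
def avoid (G : Digraph V) (b : Prop) : V → V :=
  preferring G fun _ w => ∀ n, ¬ AttackerWins G b n w

/-- With finitely many moves available, a defender who does not lose within any number of rounds
has a move to a position where the attacker does not win within any number of rounds. -/
lemma avoid_spec (hG : ∀ v, {w | G.Adj v w}.Finite) {v : V} (h : ∀ n, ¬ DefenderLoses G b n v) :
    ∀ n, ¬ AttackerWins G b n (avoid G b v) := by
  refine preferring_spec (Q := fun _ w => ∀ n, ¬ AttackerWins G b n w) (v := v) ?_
  by_contra! hc
  choose! f hf using hc
  obtain ⟨N, hN⟩ := ((hG v).image f).bddAbove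
  exact h (N + 1) fun w hw => (hf w hw).mono (hN (mem_image_of_mem f hw))

lemma avoid_avoids (hG : ∀ v, {w | G.Adj v w}.Finite) {σ : V → V} (hσ : IsStrategy G σ) (k : ℕ) :
    (∀ v, (∀ n, ¬ DefenderLoses G b n v) → (Even k ∨ b) → ¬ EndsAfter G (avoid G b) σ v k) ∧
    (∀ v, (∀ n, ¬ AttackerWins G b n v) → (Odd k ∨ b) → ¬ EndsAfter G σ (avoid G b) v k) := by
  induction k with
  | zero =>
    refine ⟨fun v h _ he => ?_, fun v h hb he => ?_⟩
    · exact h 1 fun w hw => absurd ⟨w, hw⟩ (endsAfter_zero.1 he)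
    · exact h 0 (Or.inl ⟨by simpa using hb, endsAfter_zero.1 he⟩)
  | succ k ih =>
    simp only [endsAfter_succ, Nat.even_add_one, Nat.odd_add_one, Nat.not_even_iff_odd,
      Nat.not_odd_iff_even]
    refine ⟨fun v h hb he => ?_, fun v h hb he => ?_⟩
    · exact ih.2 _ (avoid_spec hG h) hb he.2
    · exact ih.1 _ (fun n hn => h n (Or.inr ⟨_, hσ v he.1, hn⟩)) hb he.2

/-- In a graph with finite out-degrees, a player who moves second and can force a good end can do so
within a bounded number of rounds. -/
lemma forces_second_iff (hG : ∀ v, {w | G.Adj v w}.Finite) (v : V) :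
    (∃ τ, IsStrategy G τ ∧ ∀ σ, IsStrategy G σ → ∃ n, (Even n ∨ b) ∧ EndsAfter G σ τ v n) ↔
      ∃ n, DefenderLoses G b n v := by
  constructor
  · rintro ⟨τ, hτ, h⟩
    by_contra! hc
    obtain ⟨k, hk, he⟩ := h (avoid G b) (preferring_isStrategy _)
    exact (avoid_avoids hG hτ k).1 v hc hk he
  · rintro ⟨n, hn⟩
    exact ⟨attack G b, preferring_isStrategy _, fun σ hσ => (attack_wins n v σ hσ).1 hn⟩

lemma forces_first_iff (hG : ∀ v, {w | G.Adj v w}.Finite) (v : V) :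
    (∃ σ, IsStrategy G σ ∧ ∀ τ, IsStrategy G τ → ∃ n, (Odd n ∨ b) ∧ EndsAfter G σ τ v n) ↔
      ∃ n, AttackerWins G b n v := by
  constructor
  · rintro ⟨σ, hσ, h⟩
    by_contra! hc
    obtain ⟨k, hk, he⟩ := h (avoid G b) (preferring_isStrategy _)
    exact (avoid_avoids hG hσ k).2 v hc hk he
  · rintro ⟨n, hn⟩
    exact ⟨attack G b, preferring_isStrategy _, fun σ hσ => (attack_wins n v σ hσ).2 hn⟩

lemma nextWins_iff (hG : ∀ v, {w | G.Adj v w}.Finite) (v : V) :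
    NextWins G v ↔ ∃ n, AttackerWins G False n v := by
  simp [← forces_first_iff hG, NextWins]

lemma previousWins_iff (hG : ∀ v, {w | G.Adj v w}.Finite) (v : V) :
    PreviousWins G v ↔ ∃ n, DefenderLoses G False n v := by
  simp [← forces_second_iff hG, PreviousWins]

lemma stopperWinsSecond_iff (hG : ∀ v, {w | G.Adj v w}.Finite) (v : V) :
    StopperWinsSecond G v ↔ ∃ n, DefenderLoses G True n v := by
  simp [← forces_second_iff hG, StopperWinsSecond]

end Levels

/-! ### The recursion on a Galton–Watson tree -/

section Recursion

/-- The numbers of children in the subtree of the child `i` of the root. -/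
def subtree (i : ℕ) (ω : List ℕ → ℕ) : List ℕ → ℕ := fun u => ω (i :: u)

lemma familyTree_finite (ω : List ℕ → ℕ) (v : List ℕ) : {w | (familyTree ω).Adj v w}.Finite := by
  refine ((Set.finite_Iio (ω v)).image fun i => v ++ [i]).subset ?_
  rintro w ⟨i, hi, rfl⟩
  exact ⟨i, hi, rfl⟩

lemma familyTree_adj {ω : List ℕ → ℕ} {v w : List ℕ} :
    (familyTree ω).Adj v w ↔ ∃ i < ω v, w = v ++ [i] := Iff.rfl

lemma forall_familyTree_adj {ω : List ℕ → ℕ} {v : List ℕ} {Q : List ℕ → Prop} :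
    (∀ w, (familyTree ω).Adj v w → Q w) ↔ ∀ i < ω v, Q (v ++ [i]) := by
  simp only [familyTree_adj]
  exact ⟨fun h i hi => h _ ⟨i, hi, rfl⟩, fun h w ⟨i, hi, hw⟩ => hw ▸ h i hi⟩

lemma exists_familyTree_adj {ω : List ℕ → ℕ} {v : List ℕ} {Q : List ℕ → Prop} :
    (∃ w, (familyTree ω).Adj v w ∧ Q w) ↔ ∃ i < ω v, Q (v ++ [i]) := by
  simp only [familyTree_adj]
  exact ⟨fun ⟨w, ⟨i, hi, hw⟩, h⟩ => ⟨i, hi, hw ▸ h⟩, fun ⟨i, hi, h⟩ => ⟨_, ⟨i, hi, rfl⟩, h⟩⟩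

lemma hasMove_familyTree {ω : List ℕ → ℕ} {v : List ℕ} :
    HasMove (familyTree ω) v ↔ ω v ≠ 0 := by
  simp only [HasMove, familyTree_adj]
  exact ⟨fun ⟨_, i, hi, _⟩ => by omega, fun h => ⟨_, 0, by omega, rfl⟩⟩

lemma defenderLoses_cons (b : Prop) (n : ℕ) (i : ℕ) (ω : List ℕ → ℕ) (u : List ℕ) :
    DefenderLoses (familyTree ω) b n (i :: u) ↔
      DefenderLoses (familyTree (subtree i ω)) b n u := by
  induction n generalizing u with
  | zero => rfl
  | succ n ih =>
    simp only [DefenderLoses, hasMove_familyTree, forall_familyTree_adj, exists_familyTree_adj,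
      List.cons_append, ih]
    rfl

lemma attackerWins_cons (b : Prop) (n : ℕ) (i : ℕ) (ω : List ℕ → ℕ) (u : List ℕ) :
    AttackerWins (familyTree ω) b n (i :: u) ↔
      AttackerWins (familyTree (subtree i ω)) b n u := by
  simp only [AttackerWins, hasMove_familyTree, exists_familyTree_adj, List.cons_append,
    defenderLoses_cons]
  rfl

/-- The family trees on which the defender, moving first, loses within `n` rounds. -/
def loseSet (b : Prop) (n : ℕ) : Set (List ℕ → ℕ) := {ω | DefenderLoses (familyTree ω) b n []}

/-- The family trees on which the attacker, moving first, wins within `n` rounds. -/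
def winSet (b : Prop) (n : ℕ) : Set (List ℕ → ℕ) := {ω | AttackerWins (familyTree ω) b n []}

/-- The trees all of whose subtrees at the children of the root belong to `A`. -/
def allSubtrees (A : Set (List ℕ → ℕ)) : Set (List ℕ → ℕ) :=
  {ω | ∀ i < ω [], subtree i ω ∈ A}

lemma loseSet_zero (b : Prop) : loseSet b 0 = ∅ := rfl

lemma loseSet_succ (b : Prop) (n : ℕ) : loseSet b (n + 1) = allSubtrees (winSet b n) := by
  ext ω
  change DefenderLoses (familyTree ω) b (n + 1) [] ↔ _
  simp only [defenderLoses_succ, forall_familyTree_adj, List.nil_append, attackerWins_cons]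
  rfl

lemma winSet_eq (b : Prop) (n : ℕ) :
    winSet b n = {ω | b ∧ ω [] = 0} ∪ (allSubtrees (loseSet b n)ᶜ)ᶜ := by
  ext ω
  simp only [loseSet, winSet, allSubtrees, AttackerWins, hasMove_familyTree, exists_familyTree_adj]
  simp [defenderLoses_cons]

lemma measurable_subtree (i : ℕ) : Measurable (subtree i) :=
  measurable_pi_lambda _ fun _ => measurable_pi_apply _

lemma allSubtrees_eq_iUnion (A : Set (List ℕ → ℕ)) :
    allSubtrees A = ⋃ k, {ω | ω [] = k ∧ ∀ i < k, subtree i ω ∈ A} := by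
  ext ω
  simp [allSubtrees]

lemma measurableSet_root_eq (k : ℕ) : MeasurableSet {ω : List ℕ → ℕ | ω [] = k} :=
  (measurable_pi_apply (X := fun _ : List ℕ => ℕ) []) (measurableSet_singleton k)

lemma measurableSet_level {A : Set (List ℕ → ℕ)} (hA : MeasurableSet A) (k : ℕ) :
    MeasurableSet {ω : List ℕ → ℕ | ω [] = k ∧ ∀ i < k, subtree i ω ∈ A} := by
  have h1 := measurableSet_root_eq k
  have h2 : {ω : List ℕ → ℕ | ω [] = k ∧ ∀ i < k, subtree i ω ∈ A} =
      {ω | ω [] = k} ∩ ⋂ i ∈ Finset.range k, subtree i ⁻¹' A := by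
    ext ω
    simp
  rw [h2]
  exact h1.inter (Finset.measurableSet_biInter _ fun i _ => measurable_subtree i hA)

lemma measurableSet_allSubtrees {A : Set (List ℕ → ℕ)} (hA : MeasurableSet A) :
    MeasurableSet (allSubtrees A) := by
  rw [allSubtrees_eq_iUnion]
  exact .iUnion fun k => measurableSet_level hA k

lemma measurableSet_childless (b : Prop) : MeasurableSet {ω : List ℕ → ℕ | b ∧ ω [] = 0} := by
  by_cases hb : b
  · simpa [hb] using measurableSet_root_eq 0
  · simp [hb]

mutual
lemma measurableSet_loseSet (b : Prop) : ∀ n, MeasurableSet (loseSet b n)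
  | 0 => MeasurableSet.empty
  | n + 1 => by
    rw [loseSet_succ]
    exact measurableSet_allSubtrees (measurableSet_winSet b n)

lemma measurableSet_winSet (b : Prop) (n : ℕ) : MeasurableSet (winSet b n) := by
  rw [winSet_eq]
  exact (measurableSet_childless b).union
    (measurableSet_allSubtrees (measurableSet_loseSet b n).compl).compl
end

variable (p : PMF ℕ)

instance : IsProbabilityMeasure (galtonWatson p) := by
  unfold galtonWatson; infer_instance

/-- The positions of the individuals, sorted by the child of the root they descend from. -/
def Descendants : Option ℕ → Type
  | none => Unit
  | some _ => List ℕ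

/-- The word of an individual, from the child of the root it descends from and its word relative to
that child. -/
def wordOf : (Σ i, Descendants i) → List ℕ
  | ⟨none, _⟩ => []
  | ⟨some i, u⟩ => i :: (show List ℕ from u)

lemma wordOf_injective : Function.Injective wordOf := by
  rintro ⟨_ | i, u⟩ ⟨_ | j, v⟩ h
  · rfl
  · cases h
  · cases h
  · obtain ⟨rfl, rfl⟩ := List.cons.inj h
    rfl

/-- The branching property: the number of children of the root and the subtrees at these children
are independent, and each subtree has the law of the whole tree. -/
lemma galtonWatson_level {A : Set (List ℕ → ℕ)} (hA : MeasurableSet A) (k : ℕ) :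
    galtonWatson p {ω | ω [] = k ∧ ∀ i < k, subtree i ω ∈ A} = p k * galtonWatson p A ^ k := by
  let ν : Measure (Π i : Option ℕ, Descendants i → ℕ) :=
    Measure.infinitePi fun i => Measure.infinitePi fun _ : Descendants i => p.toMeasure
  let g : (List ℕ → ℕ) → Π i : Option ℕ, Descendants i → ℕ := fun ω i u => ω (wordOf ⟨i, u⟩)
  have hg : Measurable g :=
    measurable_pi_lambda _ fun i => measurable_pi_lambda _ fun u => measurable_pi_apply _
  have hmap : (galtonWatson p).map g = ν := by
    have h1 := Measure.map_infinitePi_infinitePi_of_inj (P := fun _ : List ℕ => p.toMeasure)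
      wordOf_injective
    have h2 := Measure.infinitePi_map_piCurry (κ := Descendants) (X := fun _ _ => ℕ)
      (fun _ _ => p.toMeasure)
    rw [← h1, Measure.map_map (by fun_prop) (by fun_prop)] at h2
    exact h2
  let t : Π i : Option ℕ, Set (Descendants i → ℕ) := fun i => match i with
    | none => {x | x () = k}
    | some _ => A
  have ht : ∀ i, MeasurableSet (t i) := by
    rintro (_ | i)
    · exact (measurable_pi_apply (X := fun _ : Unit => ℕ) ()) (measurableSet_singleton k)
    · exact hA
  have hset : {ω | ω [] = k ∧ ∀ i < k, subtree i ω ∈ A} =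
      g ⁻¹' (Set.pi (Finset.insertNone (Finset.range k) : Finset (Option ℕ)) t) := by
    ext ω
    constructor
    · rintro ⟨h0, h⟩ (_ | i) hi
      · exact h0
      · exact h i (by simpa using hi)
    · intro h
      refine ⟨h none (by simp), fun i hi => h (some i) (by simpa using hi)⟩
  rw [hset, ← Measure.map_apply hg (.pi (Finset.countable_toSet _) fun i _ => ht i), hmap,
    Measure.infinitePi_pi _ fun i _ => ht i]
  rw [Finset.prod_insertNone]
  congr 1
  · have h := (measurePreserving_eval_infinitePi (fun _ : Descendants none => p.toMeasure)
      ()).measure_preimage (measurableSet_singleton k).nullMeasurableSet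
    rw [PMF.toMeasure_apply_singleton _ _ (measurableSet_singleton k)] at h
    exact h
  · change ∏ _i ∈ Finset.range k, galtonWatson p A = _
    rw [Finset.prod_const, Finset.card_range]

/-- The probability generating function of an offspring law. -/
def pgf (x : ℝ) : ℝ := ∑' k, (p k).toReal * x ^ k

lemma summable_toReal : Summable fun k => (p k).toReal :=
  ENNReal.summable_toReal (by rw [p.tsum_coe]; exact ENNReal.one_ne_top)

lemma summable_pgf {x : ℝ} (hx : x ∈ Icc (0 : ℝ) 1) : Summable fun k => (p k).toReal * x ^ k :=
  (summable_toReal p).of_nonneg_of_le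
    (fun k => mul_nonneg ENNReal.toReal_nonneg (pow_nonneg hx.1 k))
    fun _ => mul_le_of_le_one_right ENNReal.toReal_nonneg (pow_le_one₀ hx.1 hx.2)

lemma pgf_one : pgf p 1 = 1 := by
  simp only [pgf, one_pow, mul_one]
  rw [← ENNReal.tsum_toReal_eq fun k => p.apply_ne_top k, p.tsum_coe, ENNReal.toReal_one]

lemma pgf_mono {x y : ℝ} (hx : 0 ≤ x) (hxy : x ≤ y) (hy : y ≤ 1) : pgf p x ≤ pgf p y :=
  (summable_pgf p ⟨hx, hxy.trans hy⟩).tsum_le_tsum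
    (fun k => mul_le_mul_of_nonneg_left (pow_le_pow_left₀ hx hxy k) ENNReal.toReal_nonneg)
    (summable_pgf p ⟨hx.trans hxy, hy⟩)

lemma toReal_zero_le_pgf {x : ℝ} (hx : x ∈ Icc (0 : ℝ) 1) : (p 0).toReal ≤ pgf p x := by
  have h := (summable_pgf p hx).le_tsum 0
    fun k _ => mul_nonneg ENNReal.toReal_nonneg (pow_nonneg hx.1 k)
  rwa [pow_zero, mul_one] at h

lemma pgf_mem {x : ℝ} (hx : x ∈ Icc (0 : ℝ) 1) : pgf p x ∈ Icc (0 : ℝ) 1 :=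
  ⟨ENNReal.toReal_nonneg.trans (toReal_zero_le_pgf p hx),
    (pgf_mono p hx.1 hx.2 le_rfl).trans (pgf_one p).le⟩

lemma continuousOn_pgf : ContinuousOn (pgf p) (Icc 0 1) := by
  refine continuousOn_tsum (fun _ => by fun_prop) (summable_toReal p) fun k x hx => ?_
  rw [Real.norm_of_nonneg (mul_nonneg ENNReal.toReal_nonneg (pow_nonneg hx.1 k))]
  exact mul_le_of_le_one_right ENNReal.toReal_nonneg (pow_le_one₀ hx.1 hx.2)

lemma galtonWatson_allSubtrees {A : Set (List ℕ → ℕ)} (hA : MeasurableSet A) :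
    (galtonWatson p).real (allSubtrees A) = pgf p ((galtonWatson p).real A) := by
  rw [measureReal_def, allSubtrees_eq_iUnion, measure_iUnion _ (measurableSet_level hA),
    ENNReal.tsum_toReal_eq fun k => measure_ne_top _ _, pgf]
  · simp [galtonWatson_level p hA, measureReal_def]
  · intro j k hjk
    refine Set.disjoint_left.2 fun ω hj hk => hjk (hj.1.symm.trans hk.1)

open Classical in
/-- The probability of an immediate end of the game when this is good for the attacker. -/
def bonus (b : Prop) : ℝ := if b then (p 0).toReal else 0

lemma real_loseSet_succ (b : Prop) (n : ℕ) :
    (galtonWatson p).real (loseSet b (n + 1)) = pgf p ((galtonWatson p).real (winSet b n)) := by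
  rw [loseSet_succ, galtonWatson_allSubtrees p (measurableSet_winSet b n)]

lemma real_childless (b : Prop) : (galtonWatson p).real {ω | b ∧ ω [] = 0} = bonus p b := by
  by_cases hb : b
  · have h := galtonWatson_level p MeasurableSet.univ 0
    simp only [Nat.not_lt_zero, false_imp_iff, implies_true, and_true, pow_zero, mul_one] at h
    simp [bonus, hb, measureReal_def, h]
  · simp [bonus, hb]

lemma real_winSet (b : Prop) (n : ℕ) : (galtonWatson p).real (winSet b n) =
    bonus p b + (1 - pgf p (1 - (galtonWatson p).real (loseSet b n))) := by
  have hm := measurableSet_allSubtrees (measurableSet_loseSet b n).compl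
  rw [winSet_eq, measureReal_union _ hm.compl, real_childless, probReal_compl_eq_one_sub hm,
    galtonWatson_allSubtrees p (measurableSet_loseSet b n).compl,
    probReal_compl_eq_one_sub (measurableSet_loseSet b n)]
  refine Set.disjoint_left.2 fun ω h h' => h' ?_
  simp [allSubtrees, h.2]

/-- The probability that the attacker can win when moving second. -/
def probSecond (b : Prop) : ℝ :=
  (galtonWatson p).real {ω | ∃ n, DefenderLoses (familyTree ω) b n []}

/-- The probability that the attacker can win when moving first. -/
def probFirst (b : Prop) : ℝ :=
  (galtonWatson p).real {ω | ∃ n, AttackerWins (familyTree ω) b n []}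

lemma tendsto_loseSet (b : Prop) :
    Tendsto (fun n => (galtonWatson p).real (loseSet b n)) atTop (𝓝 (probSecond p b)) := by
  have h : {ω : List ℕ → ℕ | ∃ n, DefenderLoses (familyTree ω) b n []} = ⋃ n, loseSet b n := by
    ext ω
    simp [loseSet]
  rw [probSecond, h]
  refine (ENNReal.tendsto_toReal (measure_ne_top _ _)).comp (tendsto_measure_iUnion_atTop ?_)
  exact fun n m hnm ω hω => DefenderLoses.mono hω hnm

lemma tendsto_winSet (b : Prop) :
    Tendsto (fun n => (galtonWatson p).real (winSet b n)) atTop (𝓝 (probFirst p b)) := by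
  have h : {ω : List ℕ → ℕ | ∃ n, AttackerWins (familyTree ω) b n []} = ⋃ n, winSet b n := by
    ext ω
    simp [winSet]
  rw [probFirst, h]
  refine (ENNReal.tendsto_toReal (measure_ne_top _ _)).comp (tendsto_measure_iUnion_atTop ?_)
  exact fun n m hnm ω hω => AttackerWins.mono hω hnm

lemma probSecond_mem (b : Prop) : probSecond p b ∈ Icc (0 : ℝ) 1 :=
  ⟨measureReal_nonneg, measureReal_le_one⟩

lemma probFirst_mem (b : Prop) : probFirst p b ∈ Icc (0 : ℝ) 1 :=
  ⟨measureReal_nonneg, measureReal_le_one⟩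

lemma one_sub_mem {x : ℝ} (hx : x ∈ Icc (0 : ℝ) 1) : 1 - x ∈ Icc (0 : ℝ) 1 :=
  ⟨by linarith [hx.2], by linarith [hx.1]⟩

lemma tendsto_pgf {u : ℕ → ℝ} {x : ℝ} (hu : ∀ n, u n ∈ Icc (0 : ℝ) 1) (hx : x ∈ Icc (0 : ℝ) 1)
    (h : Tendsto u atTop (𝓝 x)) : Tendsto (fun n => pgf p (u n)) atTop (𝓝 (pgf p x)) :=
  (continuousOn_pgf p x hx).tendsto.comp
    (tendsto_nhdsWithin_iff.2 ⟨h, Eventually.of_forall hu⟩)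

lemma probSecond_eq (b : Prop) : probSecond p b = pgf p (probFirst p b) := by
  refine tendsto_nhds_unique ((tendsto_add_atTop_iff_nat 1).2 (tendsto_loseSet p b)) ?_
  simp only [real_loseSet_succ]
  exact tendsto_pgf p (fun n => ⟨measureReal_nonneg, measureReal_le_one⟩) (probFirst_mem p b)
    (tendsto_winSet p b)

lemma probFirst_eq (b : Prop) :
    probFirst p b = bonus p b + (1 - pgf p (1 - probSecond p b)) := by
  refine tendsto_nhds_unique (tendsto_winSet p b) ?_
  simp only [real_winSet]
  refine tendsto_const_nhds.add (tendsto_const_nhds.sub (tendsto_pgf p (fun n => ?_)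
    (one_sub_mem (probSecond_mem p b)) (tendsto_const_nhds.sub (tendsto_loseSet p b))))
  exact one_sub_mem ⟨measureReal_nonneg, measureReal_le_one⟩

lemma bonus_le (b : Prop) {x : ℝ} (hx : x ∈ Icc (0 : ℝ) 1) : bonus p b ≤ pgf p x := by
  unfold bonus
  split_ifs
  · exact toReal_zero_le_pgf p hx
  · exact (pgf_mem p hx).1

lemma bonus_nonneg (b : Prop) : 0 ≤ bonus p b := by
  unfold bonus
  split_ifs <;> simp

/-- The winning probability of the attacker moving second is the least solution of the recursion. -/
lemma probSecond_le (b : Prop) {x : ℝ} (hx : x ∈ Icc (0 : ℝ) 1)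
    (h : pgf p (bonus p b + (1 - pgf p (1 - x))) ≤ x) : probSecond p b ≤ x := by
  refine le_of_tendsto' (tendsto_loseSet p b) fun n => ?_
  induction n with
  | zero => simpa [loseSet_zero] using hx.1
  | succ n ih =>
    rw [real_loseSet_succ, real_winSet]
    have h0 : 0 ≤ (galtonWatson p).real (loseSet b n) := measureReal_nonneg
    have h1 : (galtonWatson p).real (loseSet b n) ≤ 1 := measureReal_le_one
    have h2 := pgf_mem p (one_sub_mem ⟨h0, h1⟩)
    have h3 := pgf_mono p (one_sub_mem hx).1 (sub_le_sub_left ih 1) (by linarith)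
    have h4 := bonus_le p b (one_sub_mem hx)
    have h5 := bonus_nonneg p b
    exact (pgf_mono p (by linarith [h2.2]) (by linarith) (by linarith)).trans h

lemma probN_eq_probFirst : probN p = probFirst p False := by
  simp only [probN, probFirst, nextWins_iff (familyTree_finite _)]

lemma probP_eq_probSecond : probP p = probSecond p False := by
  simp only [probP, probSecond, previousWins_iff (familyTree_finite _)]

lemma probS2_eq_probSecond : probS2 p = probSecond p True := by
  simp only [probS2, probSecond, stopperWinsSecond_iff (familyTree_finite _)]

lemma probN_mem : probN p ∈ Icc (0 : ℝ) 1 := probN_eq_probFirst p ▸ probFirst_mem p _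

lemma probP_eq : probP p = pgf p (probN p) := by
  rw [probP_eq_probSecond, probN_eq_probFirst, probSecond_eq]

lemma probN_eq : probN p = 1 - pgf p (1 - probP p) := by
  rw [probP_eq_probSecond, probN_eq_probFirst, probFirst_eq]
  simp [bonus]

/-- `N` is the least fixed point of the twofold iterate of `x ↦ 1 - pgf p x`. -/
lemma probN_le {x : ℝ} (hx : x ∈ Icc (0 : ℝ) 1) (h : 1 - pgf p (1 - pgf p x) ≤ x) :
    probN p ≤ x := by
  have hG := pgf_mem p hx
  have hP : probP p ≤ pgf p x := by
    rw [probP_eq_probSecond]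
    refine probSecond_le p False hG ?_
    have := pgf_mem p (one_sub_mem hG)
    simpa [bonus] using pgf_mono p (by linarith [this.2]) h hx.2
  rw [probN_eq]
  linarith [pgf_mono p (one_sub_mem hG).1 (sub_le_sub_left hP 1)
    (by rw [probP_eq]; linarith [(pgf_mem p (probN_mem p)).1])]

lemma probE1_mem : probE1 p ∈ Icc (0 : ℝ) 1 := by
  rw [probE1, probS2_eq_probSecond]
  exact one_sub_mem (probSecond_mem p _)

lemma probE1_eq :
    probE1 p = 1 - pgf p ((p 0).toReal + 1 - pgf p (probE1 p)) := by
  have h1 := probSecond_eq p True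
  rw [probFirst_eq] at h1
  rw [probE1, probS2_eq_probSecond]
  nth_rewrite 1 [h1]
  simp [bonus, add_sub_assoc]

/-- `E⁽¹⁾` is the greatest fixed point of the recursion for the escape game. -/
lemma le_probE1 {y : ℝ} (hy : y ∈ Icc (0 : ℝ) 1)
    (h : y ≤ 1 - pgf p ((p 0).toReal + 1 - pgf p y)) : y ≤ probE1 p := by
  have := probSecond_le p True (one_sub_mem hy) (by
    simp only [bonus, if_true, sub_sub_cancel]
    rw [← add_sub_assoc]
    linarith)
  rw [probE1, probS2_eq_probSecond]
  linarith

end Recursion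

/-! ### Randomly sterilised offspring laws -/

section Laws

/-- A probability law on `{0, …, K}` given by real weights. -/
structure Weights where
  /-- the weight of each value -/
  w : ℕ → ℝ
  /-- a bound for the support -/
  K : ℕ
  nonneg : ∀ k, 0 ≤ w k
  eq_zero : ∀ k, K < k → w k = 0
  sum_eq_one : ∑ k ∈ Finset.range (K + 1), w k = 1

namespace Weights

variable (q : Weights)

/-- The probability of `k` under the mixture `(1 - t) δ₀ + t q`. -/
def mix (t : ℝ) (k : ℕ) : ℝ := (if k = 0 then 1 - t else 0) + t * q.w k

lemma mix_nonneg {t : ℝ} (ht : t ∈ Icc (0 : ℝ) 1) (k : ℕ) : 0 ≤ q.mix t k := by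
  have := mul_nonneg ht.1 (q.nonneg k)
  unfold mix
  split_ifs <;> linarith [ht.2]

/-- The offspring law `(1 - t) δ₀ + t q`: an individual is sterile with probability `1 - t` and has
offspring law `q` otherwise. The parameter is clamped to `[0, 1]`. -/
def law (t : ℝ) : PMF ℕ :=
  PMF.ofFinset (fun k => ENNReal.ofReal (q.mix (max 0 (min 1 t)) k)) (Finset.range (q.K + 1))
    (by
      have ht : max 0 (min 1 t) ∈ Icc (0 : ℝ) 1 := by simp
      rw [← ENNReal.ofReal_sum_of_nonneg fun k _ => q.mix_nonneg ht k]
      simp [mix, Finset.sum_add_distrib, ← Finset.mul_sum, q.sum_eq_one])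
    (by
      intro k hk
      have hk' : q.K < k := by simpa using hk
      simp [mix, q.eq_zero k hk', (Nat.zero_le _).trans_lt hk' |>.ne'])

lemma law_toReal (t : ℝ) (k : ℕ) : (q.law t k).toReal = q.mix (max 0 (min 1 t)) k :=
  ENNReal.toReal_ofReal (q.mix_nonneg (by simp) k)

lemma law_toReal_of_mem {t : ℝ} (ht : t ∈ Icc (0 : ℝ) 1) (k : ℕ) :
    (q.law t k).toReal = q.mix t k := by
  rw [law_toReal, min_eq_right ht.2, max_eq_right ht.1]

lemma law_eq_zero (t : ℝ) {k : ℕ} (hk : q.K < k) : q.law t k = 0 :=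
  PMF.ofFinset_apply_of_notMem _ _ (by simpa using hk)

lemma uniformlyBoundedSupport : UniformlyBoundedSupport q.law :=
  ⟨q.K, fun t _ _ hk => q.law_eq_zero t hk⟩

lemma continuousFamily : ContinuousFamily q.law := by
  intro t _
  have h : ∀ s, l1Dist (q.law s) (q.law t) = ∑ k ∈ Finset.range (q.K + 1),
      |q.mix (max 0 (min 1 s)) k - q.mix (max 0 (min 1 t)) k| := by
    intro s
    rw [l1Dist, tsum_eq_sum (s := Finset.range (q.K + 1))]
    · simp only [law_toReal]
    · intro k hk
      have hk' : q.K < k := by simpa using hk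
      simp [q.law_eq_zero _ hk']
  simp only [h]
  have hc : Continuous fun s => ∑ k ∈ Finset.range (q.K + 1),
      |q.mix (max 0 (min 1 s)) k - q.mix (max 0 (min 1 t)) k| := by
    refine continuous_finsetSum _ fun k _ => ?_
    unfold mix
    split_ifs <;> fun_prop
  simpa using hc.tendsto t

lemma pgf_law {t : ℝ} (ht : t ∈ Icc (0 : ℝ) 1) (x : ℝ) :
    pgf (q.law t) x = 1 - t + t * ∑ k ∈ Finset.range (q.K + 1), q.w k * x ^ k := by
  rw [pgf, tsum_eq_sum (s := Finset.range (q.K + 1))]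
  · simp only [q.law_toReal_of_mem ht, mix, add_mul, Finset.sum_add_distrib, Finset.mul_sum,
      mul_assoc]
    simp
  · intro k hk
    have hk' : q.K < k := by simpa using hk
    simp [q.law_eq_zero _ hk']

end Weights

end Laws

/-! ### Two-cycles of the recursion for the normal game -/

/-- An offspring law on `{1, 2, 7}` with weights `a`, `b`, `c`. -/
structure Trinomial where
  /-- the weight of `1` -/
  a : ℝ
  /-- the weight of `2` -/
  b : ℝ
  /-- the weight of `7` -/
  c : ℝ
  a_pos : 0 < a
  b_pos : 0 < b
  c_pos : 0 < c
  sum_eq_one : a + b + c = 1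

namespace Trinomial

variable (q : Trinomial)

/-- The law as a system of weights on `{0, …, 7}`. -/
def weights : Weights where
  w k := if k = 1 then q.a else if k = 2 then q.b else if k = 7 then q.c else 0
  K := 7
  nonneg k := by
    have := q.a_pos; have := q.b_pos; have := q.c_pos
    split_ifs <;> linarith
  eq_zero k hk := by simp [show k ≠ 1 by omega, show k ≠ 2 by omega, show k ≠ 7 by omega]
  sum_eq_one := by simpa [Finset.sum_range_succ] using q.sum_eq_one

/-- The generating function of the law. -/
def Q (x : ℝ) : ℝ := q.a * x + q.b * x ^ 2 + q.c * x ^ 7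

/-- The map of which the probabilities of the outcomes of the normal game form two-cycles. -/
def F (t x : ℝ) : ℝ := t * (1 - q.Q x)

/-- The divided difference of `x ↦ x * Q x`. -/
def Φ (x y : ℝ) : ℝ :=
  q.a * (x + y) + q.b * (x ^ 2 + x * y + y ^ 2) +
    q.c * (x ^ 7 + x ^ 6 * y + x ^ 5 * y ^ 2 + x ^ 4 * y ^ 3 + x ^ 3 * y ^ 4 + x ^ 2 * y ^ 5 +
      x * y ^ 6 + y ^ 7)

/-- The divided difference of `Q`. -/
def Ψ (x y : ℝ) : ℝ :=
  q.a + q.b * (x + y) +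
    q.c * (x ^ 6 + x ^ 5 * y + x ^ 4 * y ^ 2 + x ^ 3 * y ^ 3 + x ^ 2 * y ^ 4 + x * y ^ 5 + y ^ 6)

lemma Q_zero : q.Q 0 = 0 := by simp [Q]

lemma Q_one : q.Q 1 = 1 := by simpa [Q] using q.sum_eq_one

lemma Q_le {x y : ℝ} (hx : 0 ≤ x) (hxy : x ≤ y) : q.Q x ≤ q.Q y := by
  have := q.a_pos; have := q.b_pos; have := q.c_pos
  unfold Q
  gcongr

lemma Φ_lt {x y x' y' : ℝ} (hx : 0 ≤ x) (hy : 0 ≤ y) (hxx : x ≤ x') (hyy : y ≤ y')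
    (h : x + y < x' + y') : q.Φ x y < q.Φ x' y' := by
  have := q.a_pos; have := q.b_pos; have := q.c_pos
  have hx' := hx.trans hxx
  unfold Φ
  refine add_lt_add_of_lt_of_le (add_lt_add_of_lt_of_le ?_ ?_) ?_ <;> gcongr

lemma Ψ_le {x y x' y' : ℝ} (hx : 0 ≤ x) (hy : 0 ≤ y) (hxx : x ≤ x') (hyy : y ≤ y') :
    q.Ψ x y ≤ q.Ψ x' y' := by
  have := q.a_pos; have := q.b_pos; have := q.c_pos
  have hx' := hx.trans hxx
  unfold Ψ
  gcongr

lemma Ψ_pos {x y : ℝ} (hx : 0 ≤ x) (hy : 0 ≤ y) : 0 < q.Ψ x y := by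
  have h := q.Ψ_le le_rfl le_rfl hx hy
  have h0 : q.Ψ 0 0 = q.a := by simp [Ψ]
  linarith [q.a_pos]

lemma Φ_sub_left (x y : ℝ) : q.Φ x y - q.Q x = y * q.Ψ x y := by
  unfold Φ Q Ψ
  ring

lemma Φ_sub_right (x y : ℝ) : q.Φ x y - q.Q y = x * q.Ψ x y := by
  unfold Φ Q Ψ
  ring

lemma Q_sub (x y : ℝ) : q.Q y - q.Q x = (y - x) * q.Ψ x y := by
  unfold Q Ψ
  ring

lemma continuous_Φ : Continuous fun z : ℝ × ℝ => q.Φ z.1 z.2 := by unfold Φ; fun_prop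

lemma continuous_Ψ : Continuous fun z : ℝ × ℝ => q.Ψ z.1 z.2 := by unfold Ψ; fun_prop

lemma continuous_F : Continuous fun z : ℝ × ℝ => q.F z.1 z.2 := by unfold F Q; fun_prop

variable {t : ℝ}

lemma F_mem (ht : t ∈ Icc (0 : ℝ) 1) {x : ℝ} (hx : x ∈ Icc (0 : ℝ) 1) :
    q.F t x ∈ Icc (0 : ℝ) t := by
  have h0 := q.Q_le le_rfl hx.1
  have h1 := q.Q_le hx.1 hx.2
  rw [q.Q_zero] at h0
  rw [q.Q_one] at h1
  exact ⟨mul_nonneg ht.1 (by linarith), mul_le_of_le_one_right ht.1 (by linarith)⟩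

lemma F_anti (ht : 0 ≤ t) {x y : ℝ} (hx : 0 ≤ x) (hxy : x ≤ y) : q.F t y ≤ q.F t x :=
  mul_le_mul_of_nonneg_left (by linarith [q.Q_le hx hxy]) ht

/-- `(x, y)` is a two-cycle of `F t`, or a limit of such two-cycles: on the diagonal this demands a
fixed point with multiplier `-1`. -/
structure IsCycle (t x y : ℝ) : Prop where
  nonneg : 0 ≤ x
  le : x ≤ y
  Φ_eq : q.Φ x y = 1
  Ψ_eq : t * q.Ψ x y = 1

variable {q}

lemma isCycle_of_lt {x y : ℝ} (hx : 0 ≤ x) (hxy : x < y) (h1 : q.F t x = y) (h2 : q.F t y = x) :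
    q.IsCycle t x y := by
  have hΨ : t * q.Ψ x y = 1 := by
    have h := q.Q_sub x y
    unfold F at h1 h2
    refine mul_left_cancel₀ (sub_ne_zero.2 hxy.ne') ?_
    linear_combination (-t) * h + h1 - h2
  refine ⟨hx, hxy.le, ?_, hΨ⟩
  have ht : t ≠ 0 := by
    rintro rfl
    simp at hΨ
  have h := q.Φ_sub_left x y
  unfold F at h1
  refine mul_left_cancel₀ ht ?_
  linear_combination t * h + y * hΨ - h1

namespace IsCycle

variable {x y : ℝ}

lemma F_left (h : q.IsCycle t x y) : q.F t x = y := by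
  have h1 := q.Φ_sub_left x y
  have h2 := h.Ψ_eq
  have h3 := h.Φ_eq
  unfold F
  linear_combination t * h1 - t * h3 + y * h2

lemma F_right (h : q.IsCycle t x y) : q.F t y = x := by
  have h1 := q.Φ_sub_right x y
  have h2 := h.Ψ_eq
  have h3 := h.Φ_eq
  unfold F
  linear_combination t * h1 - t * h3 + x * h2

lemma pos (h : q.IsCycle t x y) : 0 < t := by
  have h1 := q.Ψ_pos h.nonneg (h.nonneg.trans h.le)
  have h2 := h.Ψ_eq
  exact pos_of_mul_pos_left (by rw [h2]; exact one_pos) h1.le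

lemma zero_lt_and_lt_one (h : q.IsCycle t x y) (ht : t < 1) : 0 < x ∧ y < 1 := by
  have h01 : q.Φ 0 1 = 1 := by simpa [Φ] using q.sum_eq_one
  have h01' : q.Ψ 0 1 = 1 := by simpa [Ψ] using q.sum_eq_one
  have hy := h.nonneg.trans h.le
  have hy1 : y < 1 := by
    by_contra! hy1
    rcases h.nonneg.eq_or_lt with rfl | hx
    · rcases hy1.eq_or_lt with rfl | hy1
      · have := h.Ψ_eq
        rw [h01'] at this
        linarith
      · have := q.Φ_lt le_rfl zero_le_one le_rfl hy1.le (by linarith)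
        linarith [h.Φ_eq]
    · have := q.Φ_lt le_rfl zero_le_one hx.le hy1 (by linarith)
      linarith [h.Φ_eq]
  refine ⟨h.nonneg.lt_of_ne ?_, hy1⟩
  rintro rfl
  have := q.Φ_lt le_rfl hy le_rfl hy1.le (by linarith)
  linarith [h.Φ_eq]

/-- Raising the parameter pushes the two points of a cycle outwards. The product `x * (1 - Q x)`
takes the same value at both points of a cycle and decreases beyond the larger one. -/
lemma push (h : q.IsCycle t x y) {s : ℝ} (hts : t < s) (hs : s < 1) :
    q.F s (q.F s x) < x ∧ y < q.F s x := by
  have ht := h.pos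
  obtain ⟨hx0, hy1⟩ := h.zero_lt_and_lt_one (hts.trans hs)
  have hy0 := hx0.trans_le h.le
  have h1 := h.F_left
  have h2 := h.F_right
  set Y := q.F s x with hY
  have hYt : t * Y = s * y := by
    rw [hY, ← h1]
    unfold F
    ring
  have hyY : y < Y := by
    refine lt_of_mul_lt_mul_left ?_ ht.le
    rw [hYt]
    exact mul_lt_mul_of_pos_right hts hy0
  refine ⟨?_, hyY⟩
  have hΦ : 1 < q.Φ y Y := by
    rw [← h.Φ_eq]
    exact q.Φ_lt h.nonneg hy0.le h.le hyY.le (by linarith [h.le])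
  have hR : Y * (1 - q.Q Y) - y * (1 - q.Q y) = (Y - y) * (1 - q.Φ y Y) := by
    unfold Q Φ
    ring
  have hneg : (Y - y) * (1 - q.Φ y Y) < 0 :=
    mul_neg_of_pos_of_neg (by linarith) (by linarith)
  refine lt_of_mul_lt_mul_right ?_ (mul_pos ht (hy0.trans hyY)).le
  have h3 : q.F s Y * (t * Y) = s * t * (Y * (1 - q.Q Y)) := by
    unfold F
    ring
  have h4 : x * (t * Y) = s * t * (y * (1 - q.Q y)) := by
    rw [hYt, ← h2]
    unfold F
    ring
  rw [h3, h4]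
  exact mul_lt_mul_of_pos_left (by linarith) (mul_pos (ht.trans hts) ht)

lemma of_tendsto {l : Filter ℝ} [l.NeBot] {X Y : ℝ → ℝ} (hl : l ≤ 𝓝 t)
    (h : ∀ᶠ s in l, q.IsCycle s (X s) (Y s)) (hX : Tendsto X l (𝓝 x)) (hY : Tendsto Y l (𝓝 y)) :
    q.IsCycle t x y := by
  have ht : Tendsto (fun s : ℝ => s) l (𝓝 t) := tendsto_id'.2 hl
  have hXY := hX.prodMk_nhds hY
  refine ⟨ge_of_tendsto hX (h.mono fun s hs => hs.nonneg),
    le_of_tendsto_of_tendsto hX hY (h.mono fun s hs => hs.le), ?_, ?_⟩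
  · refine tendsto_nhds_unique_of_eventuallyEq ((q.continuous_Φ.tendsto _).comp hXY)
      tendsto_const_nhds (h.mono fun s hs => hs.Φ_eq)
  · refine tendsto_nhds_unique_of_eventuallyEq (ht.mul ((q.continuous_Ψ.tendsto _).comp hXY))
      tendsto_const_nhds (h.mono fun s hs => hs.Ψ_eq)

end IsCycle

variable (q)

/-! ### The normal game with a sterilised trinomial offspring law -/

/-- The probability of a win for the first player, as a function of the parameter. -/
def N (t : ℝ) : ℝ := probN (q.weights.law t)

/-- The probability of a draw, as a function of the parameter. -/
def D (t : ℝ) : ℝ := probD (q.weights.law t)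

lemma one_sub_pgf (ht : t ∈ Icc (0 : ℝ) 1) (x : ℝ) :
    1 - pgf (q.weights.law t) x = q.F t x := by
  rw [Weights.pgf_law _ ht]
  simp [weights, Finset.sum_range_succ, F, Q]
  ring

lemma N_mem (t : ℝ) : q.N t ∈ Icc (0 : ℝ) 1 := probN_mem _

lemma FF_N (ht : t ∈ Icc (0 : ℝ) 1) : q.F t (q.F t (q.N t)) = q.N t := by
  rw [← q.one_sub_pgf ht, ← q.one_sub_pgf ht, N, ← probP_eq, ← probN_eq]

lemma N_le (ht : t ∈ Icc (0 : ℝ) 1) {x : ℝ} (hx : x ∈ Icc (0 : ℝ) 1)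
    (h : q.F t (q.F t x) ≤ x) : q.N t ≤ x := by
  rw [← q.one_sub_pgf ht, ← q.one_sub_pgf ht] at h
  exact probN_le _ hx h

lemma D_eq (ht : t ∈ Icc (0 : ℝ) 1) : q.D t = q.F t (q.N t) - q.N t := by
  rw [← q.one_sub_pgf ht, D, N, probD, probP_eq]
  ring

lemma D_nonneg (ht : t ∈ Icc (0 : ℝ) 1) : 0 ≤ q.D t := by
  rw [q.D_eq ht, sub_nonneg]
  have h := q.F_mem ht (q.N_mem t)
  refine q.N_le ht ⟨h.1, h.2.trans ht.2⟩ ?_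
  rw [q.FF_N ht]

lemma D_lt_one (ht : t ∈ Ioo (0 : ℝ) 1) : q.D t < 1 := by
  have ht' := Ioo_subset_Icc_self ht
  rw [q.D_eq ht']
  linarith [(q.F_mem ht' (q.N_mem t)).2, (q.N_mem t).1, ht.2]

lemma isCycle_of_D_pos (ht : t ∈ Icc (0 : ℝ) 1) (h : 0 < q.D t) :
    q.IsCycle t (q.N t) (q.F t (q.N t)) :=
  isCycle_of_lt (q.N_mem t).1 (by linarith [q.D_eq ht]) rfl (q.FF_N ht)

variable {q} {x y : ℝ}

namespace IsCycle

lemma N_le (h : q.IsCycle t x y) (ht : t < 1) : q.N t ≤ x :=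
  q.N_le ⟨h.pos.le, ht.le⟩ ⟨h.nonneg, h.le.trans (h.zero_lt_and_lt_one ht).2.le⟩
    (by rw [h.F_left, h.F_right])

/-- If there is a cycle at all, possibly a degenerate one, then the outermost one is given by the
outcome probabilities. -/
lemma outermost (h : q.IsCycle t x y) (ht : t < 1) : q.IsCycle t (q.N t) (q.F t (q.N t)) := by
  have ht' : t ∈ Icc (0 : ℝ) 1 := ⟨h.pos.le, ht.le⟩
  rcases (q.D_nonneg ht').eq_or_lt with h0 | h0
  · have h1 := h.N_le ht
    have h2 := q.F_anti ht'.1 (q.N_mem t).1 h1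
    have h3 := h.le
    rw [h.F_left] at h2
    have h4 := q.D_eq ht'
    obtain rfl : q.N t = x := by linarith
    obtain rfl : q.F t (q.N t) = y := by linarith
    exact h
  · exact q.isCycle_of_D_pos ht' h0

lemma N_lt (h : q.IsCycle t x y) {s : ℝ} (hts : t < s) (hs : s < 1) : q.N s < x := by
  have hs' : s ∈ Icc (0 : ℝ) 1 := ⟨(h.pos.trans hts).le, hs.le⟩
  have h1 := h.zero_lt_and_lt_one (hts.trans hs)
  have h2 := (h.push hts hs).1
  refine (q.N_le hs' ⟨h.nonneg, h.le.trans h1.2.le⟩ h2.le).lt_of_ne fun h3 => ?_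
  rw [← h3, q.FF_N hs'] at h2
  exact lt_irrefl _ h2

lemma lt_D (h : q.IsCycle t x y) {s : ℝ} (hts : t < s) (hs : s < 1) : y - x < q.D s := by
  have hs' : s ∈ Icc (0 : ℝ) 1 := ⟨(h.pos.trans hts).le, hs.le⟩
  have h1 := h.N_lt hts hs
  rw [q.D_eq hs']
  linarith [(h.push hts hs).2, q.F_anti hs'.1 (q.N_mem s).1 h1.le]

lemma D_pos (h : q.IsCycle t x y) {s : ℝ} (hts : t < s) (hs : s < 1) : 0 < q.D s := by
  linarith [h.lt_D hts hs, h.le]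

lemma D_lt_D (h : q.IsCycle t x y) (ht : t < 1) {s : ℝ} (hts : t < s) (hs : s < 1) :
    q.D t < q.D s := by
  rw [q.D_eq ⟨h.pos.le, ht.le⟩]
  exact (h.outermost ht).lt_D hts hs

lemma strictAntiOn_N (h : q.IsCycle t x y) : StrictAntiOn q.N (Ico t 1) := by
  intro r hr s hs hrs
  rcases hr.1.eq_or_lt with rfl | htr
  · exact (h.outermost hr.2).N_lt hrs hs.2
  · exact (q.isCycle_of_D_pos ⟨(h.pos.trans htr).le, hr.2.le⟩
      (h.D_pos htr hr.2)).N_lt hrs hs.2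

lemma tendsto_F_N {l : Filter ℝ} {L : ℝ} (hl : l ≤ 𝓝 t) (hN : Tendsto q.N l (𝓝 L)) :
    Tendsto (fun s => q.F s (q.N s)) l (𝓝 (q.F t L)) :=
  (q.continuous_F.tendsto (t, L)).comp ((tendsto_id'.2 hl).prodMk_nhds hN)

lemma tendsto_D {l : Filter ℝ} {L : ℝ} (hl : l ≤ 𝓝 t) (ht : t ∈ Ioo (0 : ℝ) 1)
    (hN : Tendsto q.N l (𝓝 L)) : Tendsto q.D l (𝓝 (q.F t L - L)) := by
  refine ((tendsto_F_N hl hN).sub hN).congr' ?_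
  filter_upwards [hl (Icc_mem_nhds ht.1 ht.2)] with s hs
  rw [q.D_eq hs]

/-- The limits of cycles are cycles. -/
lemma of_tendsto_N {l : Filter ℝ} [l.NeBot] {L : ℝ} (hl : l ≤ 𝓝 t)
    (h : ∀ᶠ s in l, q.IsCycle s (q.N s) (q.F s (q.N s))) (hN : Tendsto q.N l (𝓝 L)) :
    q.IsCycle t L (q.F t L) :=
  of_tendsto hl h hN (tendsto_F_N hl hN)

lemma exists_tendsto_left (h : q.IsCycle t x y) {s : ℝ} (hts : t < s) (hs : s < 1) :
    ∃ L, Tendsto q.N (𝓝[<] s) (𝓝 L) ∧ q.IsCycle s L (q.F s L) := by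
  have hmono : MonotoneOn (fun r => -q.N r) (Ioo t s) := fun r hr r' hr' hrr =>
    neg_le_neg (h.strictAntiOn_N.antitoneOn ⟨hr.1.le, hr.2.trans hs⟩ ⟨hr'.1.le, hr'.2.trans hs⟩ hrr)
  have hbdd : BddAbove ((fun r => -q.N r) '' Ioo t s) := by
    refine ⟨0, ?_⟩
    rintro _ ⟨r, -, rfl⟩
    exact neg_nonpos.2 (q.N_mem r).1
  have hlim := (hmono.tendsto_nhdsWithin_Ioo_left (nonempty_Ioo.2 hts) hbdd).neg
  simp only [neg_neg] at hlim
  refine ⟨_, hlim, of_tendsto_N nhdsWithin_le_nhds ?_ hlim⟩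
  filter_upwards [Ioo_mem_nhdsLT hts] with r hr
  exact q.isCycle_of_D_pos ⟨(h.pos.trans hr.1).le, (hr.2.trans hs).le⟩
    (h.D_pos hr.1 (hr.2.trans hs))

lemma exists_tendsto_right {s : ℝ} (hs : s ∈ Ico (0 : ℝ) 1) (h : ∀ t ∈ Ioo s 1, 0 < q.D t) :
    ∃ L, Tendsto q.N (𝓝[>] s) (𝓝 L) ∧ q.IsCycle s L (q.F s L) := by
  have hcyc : ∀ t ∈ Ioo s 1, q.IsCycle t (q.N t) (q.F t (q.N t)) := fun t ht =>
    q.isCycle_of_D_pos ⟨hs.1.trans ht.1.le, ht.2.le⟩ (h t ht)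
  have hmono : MonotoneOn (fun r => -q.N r) (Ioo s 1) := fun r hr r' hr' hrr =>
    neg_le_neg ((hcyc r hr).strictAntiOn_N.antitoneOn ⟨le_rfl, hr.2⟩ ⟨hrr, hr'.2⟩ hrr)
  have hbdd : BddBelow ((fun r => -q.N r) '' Ioo s 1) := by
    refine ⟨-1, ?_⟩
    rintro _ ⟨r, -, rfl⟩
    exact neg_le_neg (q.N_mem r).2
  have hlim := (hmono.tendsto_nhdsWithin_Ioo_right (nonempty_Ioo.2 hs.2) hbdd).neg
  simp only [neg_neg] at hlim
  refine ⟨_, hlim, of_tendsto_N nhdsWithin_le_nhds ?_ hlim⟩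
  filter_upwards [Ioo_mem_nhdsGT hs.2] with r hr
  exact hcyc r hr

lemma tendsto_N_right (h : q.IsCycle t x y) (ht : t < 1) :
    Tendsto q.N (𝓝[>] t) (𝓝 (q.N t)) := by
  obtain ⟨L, hL, hc⟩ := exists_tendsto_right ⟨h.pos.le, ht⟩
    fun s hs => h.D_pos hs.1 hs.2
  have h1 := hc.N_le ht
  have h2 : L ≤ q.N t := by
    refine le_of_tendsto hL ?_
    filter_upwards [Ioo_mem_nhdsGT ht] with s hs
    exact ((h.outermost ht).N_lt hs.1 hs.2).le
  rwa [le_antisymm h2 h1] at hL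

end IsCycle


variable (q : Trinomial) {t : ℝ}

/-! ### Criteria for the two kinds of phase transition -/

lemma D_pos_of_le (ht : t ∈ Icc (0 : ℝ) 1) {z : ℝ} (hz : z ∈ Icc (0 : ℝ) 1)
    (h : q.F t (q.F t z) ≤ z) (hlt : z < q.F t z) : 0 < q.D t := by
  have h1 := q.N_le ht hz h
  rw [q.D_eq ht]
  linarith [q.F_anti ht.1 (q.N_mem t).1 h1]

lemma Φ_diag_lt {x y : ℝ} (hx : 0 ≤ x) (hxy : x < y) : q.Φ x x < q.Φ y y :=
  q.Φ_lt hx hx hxy.le hxy.le (by linarith)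

/-- The parameter at which the fixed point has multiplier `-1`. -/
lemma exists_diag : ∃ t m, q.IsCycle t m m := by
  have h0 : q.Φ 0 0 = 0 := by simp [Φ]
  have h1 : 1 ≤ q.Φ 1 1 := by
    have := q.a_pos; have := q.b_pos; have := q.c_pos
    simp only [Φ]
    linarith [q.sum_eq_one]
  have hc : Continuous fun x => q.Φ x x := q.continuous_Φ.comp (continuous_id.prodMk continuous_id)
  obtain ⟨m, hm, hm1⟩ := intermediate_value_Icc zero_le_one hc.continuousOn
    (show (1 : ℝ) ∈ Icc (q.Φ 0 0) (q.Φ 1 1) from ⟨by rw [h0]; exact zero_le_one, h1⟩)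
  exact ⟨1 / q.Ψ m m, m, hm.1, le_rfl, hm1, one_div_mul_cancel (q.Ψ_pos hm.1 hm.1).ne'⟩

/-- If a proper two-cycle exists for a parameter `s` smaller than the one at which the fixed point
gets multiplier `-1`, then the transition is discontinuous: a cycle at the critical parameter is a
limit of cycles and cannot lie on the diagonal. -/
lemma discontinuous_transition {s z u : ℝ} (hs : s ∈ Ioo (0 : ℝ) 1) (hz : z ∈ Icc (0 : ℝ) 1)
    (hFF : q.F s (q.F s z) ≤ z) (hF : z < q.F s z) (hu : 0 ≤ u) (hΦ : 1 ≤ q.Φ u u)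
    (hΨ : s * q.Ψ u u < 1) :
    ∃ t₀ ∈ Ioo (0 : ℝ) 1, (∀ t ∈ Ioo (0 : ℝ) 1, t < t₀ → q.D t = 0) ∧
      (∀ t ∈ Ioo (0 : ℝ) 1, t₀ ≤ t → q.D t ∈ Ioo (0 : ℝ) 1) := by
  set S := {t ∈ Ioo (0 : ℝ) 1 | 0 < q.D t}
  have hcyc : ∀ t ∈ S, q.IsCycle t (q.N t) (q.F t (q.N t)) := fun t ht =>
    q.isCycle_of_D_pos (Ioo_subset_Icc_self ht.1) ht.2
  have hΨ1 : 0 < q.Ψ 1 1 := q.Ψ_pos zero_le_one zero_le_one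
  have hlb : ∀ t ∈ S, 1 / q.Ψ 1 1 ≤ t := by
    intro t ht
    have hc := hcyc t ht
    rw [div_le_iff₀ hΨ1]
    have h1 := q.F_mem (Ioo_subset_Icc_self ht.1) (q.N_mem t)
    exact hc.Ψ_eq.ge.trans (mul_le_mul_of_nonneg_left
      (q.Ψ_le hc.nonneg h1.1 (q.N_mem t).2 (h1.2.trans ht.1.2.le)) ht.1.1.le)
  have hsS : s ∈ S := ⟨hs, q.D_pos_of_le (Ioo_subset_Icc_self hs) hz hFF hF⟩
  have hbdd : BddBelow S := ⟨_, hlb⟩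
  have hle : sInf S ≤ s := csInf_le hbdd hsS
  have hpos : 0 < sInf S := (one_div_pos.2 hΨ1).trans_le (le_csInf ⟨s, hsS⟩ hlb)
  have hlt : sInf S < 1 := hle.trans_lt hs.2
  have habove : ∀ t ∈ Ioo (sInf S) 1, 0 < q.D t := by
    intro t ht
    obtain ⟨r, hr, hrt⟩ := exists_lt_of_csInf_lt ⟨s, hsS⟩ ht.1
    exact (hcyc r hr).D_pos hrt ht.2
  refine ⟨sInf S, ⟨hpos, hlt⟩, fun t ht htl => ?_, fun t ht htl => ⟨?_, q.D_lt_one ht⟩⟩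
  · refine le_antisymm (not_lt.1 fun h => ?_) (q.D_nonneg (Ioo_subset_Icc_self ht))
    exact notMem_of_lt_csInf htl hbdd ⟨ht, h⟩
  · rcases htl.eq_or_lt with rfl | htl
    · obtain ⟨L, -, hL⟩ := IsCycle.exists_tendsto_right ⟨hpos.le, hlt⟩ habove
      have hL1 := hL.zero_lt_and_lt_one hlt
      refine q.D_pos_of_le (Ioo_subset_Icc_self ht) ⟨hL.nonneg, hL.le.trans hL1.2.le⟩
        hL.F_right.le (hL.le.lt_of_ne fun heq => ?_)
      rw [← heq] at hL
      have hLu : L ≤ u := by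
        by_contra! h
        linarith [q.Φ_diag_lt hu h, hL.Φ_eq]
      have h1 := q.Ψ_le hL.nonneg hL.nonneg hLu hLu
      have h2 := q.Ψ_pos hu hu
      have h3 := hL.Ψ_eq
      have h4 := mul_le_mul_of_nonneg_left h1 hpos.le
      have h5 := mul_le_mul_of_nonneg_right hle h2.le
      linarith
    · exact habove t ⟨htl, ht.2⟩

/-- Suppose that cycles with smaller point in `[x₁, m]`, where `m` is the point of the degenerate
cycle, move outwards strictly with the parameter, that at some parameter `lo` beyond the degenerate
cycle all cycles have smaller point above `x₁`, and that at a later parameter `hi` there is a cycle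
with smaller point below `x₁` but the parameter of a cycle through `x₁` has not been reached. Then
the outermost cycle emerges continuously from the degenerate one and jumps later on. -/
lemma continuous_then_jump {x₁ z lo hi u : ℝ}
    (hanti : ∀ t x y t' x' y', q.IsCycle t x y → q.IsCycle t' x' y' → x₁ ≤ x → x < x' → t' < t)
    (hu : 0 ≤ u) (hΦ : q.Φ u u ≤ 1) (hlo : 0 < lo) (hΨ : 1 < lo * q.Ψ u u) (hlohi : lo < hi)
    (hhi : hi < 1) (hN : x₁ < q.N lo) (hz : 0 ≤ z) (hzx : z < x₁)
    (hFFz : q.F hi (q.F hi z) ≤ z) (hFFx : x₁ < q.F hi (q.F hi x₁)) :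
    ∃ t₁ t₂ : ℝ, 0 < t₁ ∧ t₁ < t₂ ∧ t₂ < 1 ∧ (∀ t ∈ Ioc 0 t₁, q.D t = 0) ∧
      ContinuousOn q.D (Ioo 0 t₂) ∧ StrictMonoOn q.D (Ico t₁ t₂) ∧
      ∃ a b : ℝ, 0 < a ∧ a < b ∧ b < 1 ∧ Tendsto q.D (𝓝[<] t₂) (𝓝 a) ∧
        Tendsto q.D (𝓝[>] t₂) (𝓝 b) ∧ q.D t₂ = b := by
  obtain ⟨t₁, m, hm⟩ := q.exists_diag
  have hum : u ≤ m := by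
    by_contra! h
    linarith [q.Φ_diag_lt hm.nonneg h, hm.Φ_eq]
  have ht₁lo : t₁ < lo := by
    have h1 := q.Ψ_le hu hu hum hum
    have h2 := mul_le_mul_of_nonneg_left h1 hlo.le
    refine lt_of_mul_lt_mul_right ?_ (q.Ψ_pos hm.nonneg hm.nonneg).le
    rw [hm.Ψ_eq]
    linarith
  have hlo1 : lo < 1 := hlohi.trans hhi
  have ht₁1 : t₁ < 1 := ht₁lo.trans hlo1
  have hzero : ∀ t ∈ Ioc 0 t₁, q.D t = 0 := by
    intro t ht
    have ht' : t ∈ Icc (0 : ℝ) 1 := ⟨ht.1.le, ht.2.trans ht₁1.le⟩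
    refine le_antisymm (not_lt.1 fun h => ?_) (q.D_nonneg ht')
    have hc := q.isCycle_of_D_pos ht' h
    have h1 : x₁ < q.N t := hN.trans (hc.N_lt (ht.2.trans_lt ht₁lo) hlo1)
    rcases lt_or_ge (q.N t) m with h2 | h2
    · exact (hanti _ _ _ _ _ _ hc hm h1.le h2).not_ge ht.2
    · have h3 : q.N t < q.F t (q.N t) := by linarith [q.D_eq ht']
      have := q.Φ_lt hm.nonneg hm.nonneg h2 (h2.trans h3.le) (by linarith)
      linarith [hm.Φ_eq, hc.Φ_eq]
  have hDm : StrictMonoOn q.D (Ico t₁ 1) := by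
    intro r hr s hs hrs
    rcases hr.1.eq_or_lt with rfl | h
    · exact hm.D_lt_D hr.2 hrs hs.2
    · exact (q.isCycle_of_D_pos ⟨(hm.pos.trans h).le, hr.2.le⟩
        (hm.D_pos h hr.2)).D_lt_D hr.2 hrs hs.2
  have hcyc : ∀ t ∈ Ico t₁ 1, q.IsCycle t (q.N t) (q.F t (q.N t)) := by
    intro t ht
    rcases ht.1.eq_or_lt with rfl | h
    · exact hm.outermost ht.2
    · exact q.isCycle_of_D_pos ⟨(hm.pos.trans h).le, ht.2.le⟩ (hm.D_pos h ht.2)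
  have hNanti := hm.strictAntiOn_N
  set A := {t ∈ Ioo t₁ 1 | q.N t < x₁}
  have hhi0 : hi ∈ Icc (0 : ℝ) 1 := ⟨(hlo.trans hlohi).le, hhi.le⟩
  have hx₁1 : x₁ ≤ 1 := hN.le.trans (q.N_mem lo).2
  have hhiA : hi ∈ A :=
    ⟨⟨ht₁lo.trans hlohi, hhi⟩, (q.N_le hhi0 ⟨hz, hzx.le.trans hx₁1⟩ hFFz).trans_lt hzx⟩
  have hlb : ∀ t ∈ A, lo ≤ t := by
    intro t ht
    by_contra! h
    linarith [ht.2, hNanti ⟨ht.1.1.le, ht.1.2⟩ ⟨ht₁lo.le, hlo1⟩ h]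
  have hbdd : BddBelow A := ⟨lo, hlb⟩
  set t₂ := sInf A
  have hlot₂ : lo ≤ t₂ := le_csInf ⟨hi, hhiA⟩ hlb
  have ht₂hi : t₂ ≤ hi := csInf_le hbdd hhiA
  have ht₂1 : t₂ < 1 := ht₂hi.trans_lt hhi
  have ht₁₂ : t₁ < t₂ := ht₁lo.trans_le hlot₂
  have ht₂0 : t₂ ∈ Ioo (0 : ℝ) 1 := ⟨hm.pos.trans ht₁₂, ht₂1⟩
  have hbelow : ∀ t ∈ Ioo t₁ t₂, x₁ ≤ q.N t := by
    intro t ht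
    by_contra! h
    exact notMem_of_lt_csInf ht.2 hbdd ⟨⟨ht.1, ht.2.trans ht₂1⟩, h⟩
  have hN₂ : q.N t₂ < x₁ := by
    refine lt_of_le_of_ne ?_ fun heq => ?_
    · refine le_of_tendsto ((hcyc t₂ ⟨ht₁₂.le, ht₂1⟩).tendsto_N_right ht₂1) ?_
      filter_upwards [Ioo_mem_nhdsGT ht₂1] with s hs
      obtain ⟨r, hr, hrs⟩ := exists_lt_of_csInf_lt ⟨hi, hhiA⟩ hs.1
      exact (hNanti ⟨hr.1.1.le, hr.1.2⟩ ⟨(ht₁₂.trans hs.1).le, hs.2⟩ hrs).le.trans hr.2.le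
    · have hc := hcyc t₂ ⟨ht₁₂.le, ht₂1⟩
      rw [heq] at hc
      rcases ht₂hi.eq_or_lt with h | h
      · rw [← h, hc.F_right] at hFFx
        exact lt_irrefl _ hFFx
      · exact lt_asymm (hc.push h hhi).1 hFFx
  obtain ⟨L, hL, hLc⟩ := hm.exists_tendsto_left ht₁₂ ht₂1
  have hLx : x₁ ≤ L := by
    refine ge_of_tendsto hL ?_
    filter_upwards [Ioo_mem_nhdsLT ht₁₂] with s hs
    exact hbelow s hs
  have hleft := IsCycle.tendsto_D nhdsWithin_le_nhds ht₂0 hL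
  have hright : ∀ t ∈ Ico t₁ 1, Tendsto q.D (𝓝[>] t) (𝓝 (q.D t)) := by
    intro t ht
    have h0 : t ∈ Ioo (0 : ℝ) 1 := ⟨hm.pos.trans_le ht.1, ht.2⟩
    rw [q.D_eq (Ioo_subset_Icc_self h0)]
    exact IsCycle.tendsto_D nhdsWithin_le_nhds h0 ((hcyc t ht).tendsto_N_right ht.2)
  refine ⟨t₁, t₂, hm.pos, ht₁₂, ht₂1, hzero, ?_, hDm.mono (Ico_subset_Ico_right ht₂1.le),
    q.F t₂ L - L, q.D t₂, ?_, ?_, q.D_lt_one ht₂0, hleft, hright t₂ ⟨ht₁₂.le, ht₂1⟩, rfl⟩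
  · intro t ht
    refine ContinuousAt.continuousWithinAt ?_
    have hzero_left : ∀ s ∈ Ioc 0 t₁, Tendsto q.D (𝓝[<] s) (𝓝 (q.D s)) := by
      intro s hs
      rw [hzero s hs]
      refine tendsto_const_nhds.congr' ?_
      filter_upwards [Ioo_mem_nhdsLT hs.1] with r hr
      exact (hzero r ⟨hr.1, hr.2.le.trans hs.2⟩).symm
    rcases lt_or_ge t t₁ with h | h
    · have : q.D =ᶠ[𝓝 t] fun _ => 0 := by
        filter_upwards [Ioo_mem_nhds ht.1 h] with r hr
        exact hzero r ⟨hr.1, hr.2.le⟩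
      exact continuousAt_const.congr this.symm
    · refine continuousAt_iff_continuous_left'_right'.2
        ⟨?_, hright t ⟨h, ht.2.trans ht₂1⟩⟩
      rcases h.eq_or_lt with rfl | h
      · exact hzero_left _ ⟨ht.1, le_rfl⟩
      · have ht1 := ht.2.trans ht₂1
        obtain ⟨l, hl, hlc⟩ := hm.exists_tendsto_left h ht1
        have hlx : x₁ ≤ q.N t := hbelow t ⟨h, ht.2⟩
        have hlN : l = q.N t := by
          refine le_antisymm (not_lt.1 fun hlt => ?_) (hlc.N_le ht1)
          exact lt_irrefl _ (hanti _ _ _ _ _ _ (hcyc t ⟨h.le, ht1⟩) hlc hlx hlt)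
        have h0 : t ∈ Ioo (0 : ℝ) 1 := ⟨ht.1, ht1⟩
        change Tendsto q.D (𝓝[<] t) (𝓝 (q.D t))
        rw [q.D_eq (Ioo_subset_Icc_self h0), ← hlN]
        exact IsCycle.tendsto_D nhdsWithin_le_nhds h0 hl
  · obtain ⟨r, hr1, hr2⟩ := exists_between ht₁₂
    refine (hm.D_pos hr1 (hr2.trans ht₂1)).trans_le (ge_of_tendsto hleft ?_)
    filter_upwards [Ioo_mem_nhdsLT hr2] with s hs
    exact (hDm ⟨hr1.le, hr2.trans ht₂1⟩ ⟨(hr1.trans hs.1).le, hs.2.trans ht₂1⟩ hs.1).le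
  · rw [q.D_eq (Ioo_subset_Icc_self ht₂0)]
    have := q.F_anti ht₂0.1.le (q.N_mem t₂).1 (hN₂.le.trans hLx)
    linarith


/-! ### Midpoint coordinates for cycles -/

section Midpoint

variable (q : Trinomial)

/-- `Φ` in terms of the midpoint `u` and the square `v` of half the distance of its arguments. -/
def Φm (u v : ℝ) : ℝ :=
  q.a * (2 * u) + q.b * (3 * u ^ 2 + v) +
    q.c * (8 * u ^ 7 + 56 * u ^ 5 * v + 56 * u ^ 3 * v ^ 2 + 8 * u * v ^ 3)

/-- `Ψ` in terms of the midpoint `u` and the square `v` of half the distance of its arguments. -/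
def Ψm (u v : ℝ) : ℝ :=
  q.a + q.b * (2 * u) + q.c * (7 * u ^ 6 + 35 * u ^ 4 * v + 21 * u ^ 2 * v ^ 2 + v ^ 3)

lemma Φ_eq_Φm (x y : ℝ) : q.Φ x y = q.Φm ((x + y) / 2) (((y - x) / 2) ^ 2) := by
  unfold Φ Φm
  ring

lemma Ψ_eq_Ψm (x y : ℝ) : q.Ψ x y = q.Ψm ((x + y) / 2) (((y - x) / 2) ^ 2) := by
  unfold Ψ Ψm
  ring

variable {q}

lemma Φm_lt {u v u' v' : ℝ} (hu : 0 ≤ u) (hv : 0 ≤ v) (huu : u < u') (hvv : v ≤ v') :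
    q.Φm u v < q.Φm u' v' := by
  have := q.a_pos; have := q.b_pos; have := q.c_pos
  have hu' := hu.trans huu.le
  have hv' := hv.trans hvv
  unfold Φm
  refine add_lt_add_of_lt_of_le (add_lt_add_of_lt_of_le ?_ ?_) ?_ <;> gcongr

/-- If `Ψ - lam * Φ` increases in `u` and decreases in `v` on a box, then `Ψ` decreases strictly
along the level curve `Φ = 1` in the direction of increasing `v` (and decreasing `u`). -/
lemma Ψm_lt_of_level {lam u₁ u₀ v₀ u v u' v' : ℝ}
    (hu_mono : ∀ v ∈ Icc 0 v₀, MonotoneOn (fun u => q.Ψm u v - lam * q.Φm u v) (Icc u₁ u₀))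
    (hv_anti : ∀ u ∈ Icc u₁ u₀, StrictAntiOn (fun v => q.Ψm u v - lam * q.Φm u v) (Icc 0 v₀))
    (hu : u₁ ≤ u) (huu : u ≤ u') (hu' : u' ≤ u₀) (hv : v ≤ v₀) (hvv : v' < v) (hv' : 0 ≤ v')
    (hΦ : q.Φm u v = 1) (hΦ' : q.Φm u' v' = 1) : q.Ψm u v < q.Ψm u' v' := by
  have h1 := hu_mono v ⟨hv'.trans hvv.le, hv⟩ ⟨hu, huu.trans hu'⟩ ⟨hu.trans huu, hu'⟩ huu
  have h2 := hv_anti u' ⟨hu.trans huu, hu'⟩ ⟨hv', hvv.le.trans hv⟩ ⟨hv'.trans hvv.le, hv⟩ hvv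
  simp only [hΦ, hΦ'] at h1 h2
  linarith

/-- A criterion for cycles near the degenerate one to move outwards strictly with the parameter. -/
lemma cycles_strictAnti {lam x₁ y₁ u₁ u₀ v₀ : ℝ}
    (hu_mono : ∀ v ∈ Icc 0 v₀, MonotoneOn (fun u => q.Ψm u v - lam * q.Φm u v) (Icc u₁ u₀))
    (hv_anti : ∀ u ∈ Icc u₁ u₀, StrictAntiOn (fun v => q.Ψm u v - lam * q.Φm u v) (Icc 0 v₀))
    (hx₁ : 0 ≤ x₁) (hy₁ : 0 ≤ y₁) (hxy : 1 ≤ q.Φ x₁ y₁) (hv₀ : ((y₁ - x₁) / 2) ^ 2 ≤ v₀)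
    (hu₁ : q.Φm u₁ v₀ ≤ 1) (hu₀ : 1 ≤ q.Φm u₀ 0) (hu₀' : 0 ≤ u₀)
    (t x y t' x' y' : ℝ) (h : q.IsCycle t x y) (h' : q.IsCycle t' x' y') (hx : x₁ ≤ x)
    (hxx : x < x') : t' < t := by
  have hyy : y' < y := by
    by_contra! hc
    have := q.Φ_lt h.nonneg (h.nonneg.trans h.le) hxx.le hc (by linarith)
    linarith [h.Φ_eq, h'.Φ_eq]
  have hyy₁ : y ≤ y₁ := by
    by_contra! hc
    have := q.Φ_lt hx₁ hy₁ hx hc.le (by linarith)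
    linarith [h.Φ_eq]
  have hxle := h.le
  have hxle' := h'.le
  have hΦ := h.Φ_eq
  have hΦ' := h'.Φ_eq
  have hΨ := h.Ψ_eq
  have hΨ' := h'.Ψ_eq
  have hx0 := h.nonneg
  rw [Φ_eq_Φm] at hΦ hΦ'
  rw [Ψ_eq_Ψm] at hΨ hΨ'
  have hvv : ((y' - x') / 2) ^ 2 < ((y - x) / 2) ^ 2 :=
    pow_lt_pow_left₀ (by linarith) (by linarith) two_ne_zero
  have hv : ((y - x) / 2) ^ 2 ≤ v₀ :=
    (pow_le_pow_left₀ (by linarith) (by linarith) 2).trans hv₀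
  have hv0' : 0 ≤ ((y' - x') / 2) ^ 2 := sq_nonneg _
  have hv0 : 0 ≤ ((y - x) / 2) ^ 2 := sq_nonneg _
  set u := (x + y) / 2 with hu_def
  set v := ((y - x) / 2) ^ 2
  set u' := (x' + y') / 2 with hu'_def
  set v' := ((y' - x') / 2) ^ 2
  have hupos : 0 ≤ u := by linarith
  have hu'pos : 0 ≤ u' := by linarith
  have huu : u ≤ u' := by
    by_contra! hc
    have := Φm_lt (q := q) hu'pos hv0' hc hvv.le
    linarith
  have hu'le : u' ≤ u₀ := by
    by_contra! hc
    have := Φm_lt (q := q) hu₀' le_rfl hc hv0'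
    linarith
  have hule : u₁ ≤ u := by
    by_contra! hc
    have := Φm_lt (q := q) hupos hv0 hc hv
    linarith
  have key := Ψm_lt_of_level hu_mono hv_anti hule huu hu'le hv hvv hv0' hΦ hΦ'
  have hΨpos : 0 < q.Ψm u v := pos_of_mul_pos_right (by rw [hΨ]; exact one_pos) h.pos.le
  by_contra! hc
  have h1 := mul_le_mul_of_nonneg_right hc hΨpos.le
  have h2 := mul_lt_mul_of_pos_left key h'.pos
  linarith

end Midpoint

/-! ### A law with a discontinuous transition -/

/-- The law with weights `1/5`, `1/2`, `3/10`. -/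
def jumpLaw : Trinomial := ⟨1 / 5, 1 / 2, 3 / 10, by norm_num, by norm_num, by norm_num, by norm_num⟩

lemma jumpLaw_transition :
    ∃ t₀ ∈ Ioo (0 : ℝ) 1, (∀ t ∈ Ioo (0 : ℝ) 1, t < t₀ → jumpLaw.D t = 0) ∧
      (∀ t ∈ Ioo (0 : ℝ) 1, t₀ ≤ t → jumpLaw.D t ∈ Ioo (0 : ℝ) 1) := by
  -- At the parameter `s` the map `F ∘ F` moves `z` down, so there is a proper cycle, while the fixed
  -- point near `u` acquires the multiplier `-1` only at a parameter above `s`, near `0.9994`.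
  refine jumpLaw.discontinuous_transition (s := 124 / 125) (z := 23 / 100) (u := 81 / 125)
    ?_ ?_ ?_ ?_ ?_ ?_ ?_ <;> norm_num [F, Q, Φ, Ψ, jumpLaw]

/-! ### A law with a continuous transition followed by a jump -/

/-- The law with weights `1/5`, `1/5`, `3/5`. -/
def twoStepLaw : Trinomial :=
  ⟨1 / 5, 1 / 5, 3 / 5, by norm_num, by norm_num, by norm_num, by norm_num⟩

/-- Bounds for monomials, which turn the polynomial inequalities below into linear ones. -/
lemma monomial_bounds {d v d₀ v₀ : ℝ} (hd : d ∈ Icc 0 d₀) (hv : v ∈ Icc 0 v₀) (i j : ℕ) :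
    0 ≤ d ^ i * v ^ j ∧ d ^ i * v ^ j ≤ d₀ ^ i * v₀ ^ j :=
  ⟨mul_nonneg (pow_nonneg hd.1 i) (pow_nonneg hv.1 j),
    mul_le_mul (pow_le_pow_left₀ hd.1 hd.2 i) (pow_le_pow_left₀ hv.1 hv.2 j)
      (pow_nonneg hv.1 j) (pow_nonneg (hd.1.trans hd.2) i)⟩

lemma twoStepLaw_mono_midpoint {v : ℝ} (hv : v ∈ Icc (0 : ℝ) (21 / 2500)) :
    MonotoneOn (fun u => twoStepLaw.Ψm u v - 7 / 8 * twoStepLaw.Φm u v)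
      (Icc (87 / 125) (353 / 500)) := by
  have hder : ∀ u : ℝ, HasDerivAt (fun u => twoStepLaw.Ψm u v - 7 / 8 * twoStepLaw.Φm u v)
      ((2 + 126 * u ^ 5 + 420 * u ^ 3 * v + 126 * u * v ^ 2 -
        7 / 8 * (2 + 6 * u + 168 * u ^ 6 + 840 * u ^ 4 * v + 504 * u ^ 2 * v ^ 2 + 24 * v ^ 3)) / 5)
      u := by
    intro u
    unfold Ψm Φm
    refine HasDerivAt.congr_deriv (HasDerivAt.sub (HasDerivAt.add (HasDerivAt.add
      (hasDerivAt_const u _) (((hasDerivAt_id u).const_mul 2).const_mul _)) ((HasDerivAt.add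
      (HasDerivAt.add (HasDerivAt.add ((hasDerivAt_pow 6 u).const_mul 7)
      (((hasDerivAt_pow 4 u).const_mul 35).mul_const v))
      (((hasDerivAt_pow 2 u).const_mul 21).mul_const _)) (hasDerivAt_const u _)).const_mul _))
      ((HasDerivAt.add (HasDerivAt.add (((hasDerivAt_id u).const_mul 2).const_mul _)
      ((((hasDerivAt_pow 2 u).const_mul 3).add_const v).const_mul _)) ((HasDerivAt.add
      (HasDerivAt.add (HasDerivAt.add ((hasDerivAt_pow 7 u).const_mul 8)
      (((hasDerivAt_pow 5 u).const_mul 56).mul_const v))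
      (((hasDerivAt_pow 3 u).const_mul 56).mul_const _))
      (((hasDerivAt_id u).const_mul 8).mul_const _)).const_mul _)).const_mul _)) ?_
    simp only [twoStepLaw]
    push_cast
    ring
  refine monotoneOn_of_deriv_nonneg (convex_Icc _ _)
    (fun u _ => (hder u).continuousAt.continuousWithinAt)
    (fun u _ => (hder u).differentiableAt.differentiableWithinAt) fun u hu => ?_
  rw [(hder u).deriv]
  rw [interior_Icc] at hu
  obtain ⟨d, rfl⟩ : ∃ d, u = 87 / 125 + d := ⟨u - 87 / 125, by ring⟩
  have hd : d ∈ Icc (0 : ℝ) (1 / 100) := ⟨by linarith [hu.1], by linarith [hu.2]⟩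
  have key := monomial_bounds hd hv
  linarith [key 1 0, key 2 0, key 3 0, key 4 0, key 5 0, key 6 0, key 0 1, key 1 1, key 2 1,
    key 3 1, key 4 1, key 0 2, key 1 2, key 2 2, key 0 3]

lemma twoStepLaw_anti_distance {u : ℝ} (hu : u ∈ Icc (87 / 125 : ℝ) (353 / 500)) :
    StrictAntiOn (fun v => twoStepLaw.Ψm u v - 7 / 8 * twoStepLaw.Φm u v)
      (Icc 0 (21 / 2500)) := by
  have hder : ∀ v : ℝ, HasDerivAt (fun v => twoStepLaw.Ψm u v - 7 / 8 * twoStepLaw.Φm u v)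
      ((105 * u ^ 4 + 126 * u ^ 2 * v + 9 * v ^ 2 -
        7 / 8 * (1 + 168 * u ^ 5 + 336 * u ^ 3 * v + 72 * u * v ^ 2)) / 5) v := by
    intro v
    unfold Ψm Φm
    refine HasDerivAt.congr_deriv (HasDerivAt.sub (HasDerivAt.const_add _ ((HasDerivAt.add
      (HasDerivAt.add (HasDerivAt.const_add _ ((hasDerivAt_id v).const_mul _))
      ((hasDerivAt_pow 2 v).const_mul _)) (hasDerivAt_pow 3 v)).const_mul _))
      ((HasDerivAt.add (HasDerivAt.const_add _ (((hasDerivAt_id v).const_add _).const_mul _))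
      ((HasDerivAt.add
      (HasDerivAt.add (HasDerivAt.const_add _ ((hasDerivAt_id v).const_mul _))
      ((hasDerivAt_pow 2 v).const_mul _)) ((hasDerivAt_pow 3 v).const_mul _)).const_mul _)).const_mul
      _)) ?_
    simp only [twoStepLaw]
    push_cast
    ring
  refine strictAntiOn_of_deriv_neg (convex_Icc _ _)
    (fun v _ => (hder v).continuousAt.continuousWithinAt) fun v hv => ?_
  rw [(hder v).deriv]
  rw [interior_Icc] at hv
  obtain ⟨d, rfl⟩ : ∃ d, u = 87 / 125 + d := ⟨u - 87 / 125, by ring⟩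
  have hd : d ∈ Icc (0 : ℝ) (1 / 100) := ⟨by linarith [hu.1], by linarith [hu.2]⟩
  have key := monomial_bounds hd (Ioo_subset_Icc_self hv)
  linarith [key 1 0, key 2 0, key 3 0, key 4 0, key 5 0, key 0 1, key 1 1, key 2 1, key 3 1,
    key 0 2, key 1 2]

/-- The numerator of `10 ^ 5 * F (4993 / 5000) (n / 10 ^ 5)` over the denominator
`25000 * 10 ^ 30`. -/
def numerator (n : ℕ) : ℕ := 4993 * (5 * 10 ^ 35 - (n * 10 ^ 30 + n ^ 2 * 10 ^ 25 + 3 * n ^ 7))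

/-- One step of the twofold iterate of `F (4993 / 5000)` on multiples of `10 ^ (-5)`, with the inner
value rounded up and the outer value rounded down. -/
def lowerStep (n : ℕ) : ℕ :=
  numerator (numerator n / (25000 * 10 ^ 30) + 1) / (25000 * 10 ^ 30)

lemma F_eq_numerator {n : ℕ} (hn : n * 10 ^ 30 + n ^ 2 * 10 ^ 25 + 3 * n ^ 7 ≤ 5 * 10 ^ 35) :
    twoStepLaw.F (4993 / 5000) (n / 10 ^ 5) = numerator n / (25000 * 10 ^ 30) / 10 ^ 5 := by
  rw [numerator, Nat.cast_mul, Nat.cast_sub hn]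
  simp only [F, Q, twoStepLaw]
  push_cast
  ring

lemma F_le_numerator (n : ℕ) :
    twoStepLaw.F (4993 / 5000) (n / 10 ^ 5) ≤ numerator n / (25000 * 10 ^ 30) / 10 ^ 5 := by
  rcases le_total (n * 10 ^ 30 + n ^ 2 * 10 ^ 25 + 3 * n ^ 7) (5 * 10 ^ 35) with hn | hn
  · exact (F_eq_numerator hn).le
  · have h1 : (5 * 10 ^ 35 : ℝ) ≤ n * 10 ^ 30 + n ^ 2 * 10 ^ 25 + 3 * n ^ 7 := by
      exact_mod_cast hn
    have h2 : twoStepLaw.F (4993 / 5000) (n / 10 ^ 5) = 4993 *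
        (5 * 10 ^ 35 - (n * 10 ^ 30 + n ^ 2 * 10 ^ 25 + 3 * n ^ 7)) /
          (25000 * 10 ^ 30) / 10 ^ 5 := by
      simp only [F, Q, twoStepLaw]
      ring
    rw [h2, numerator, Nat.sub_eq_zero_of_le hn]
    push_cast
    gcongr
    linarith

lemma lowerStep_le {n : ℕ} (hn : (n / 10 ^ 5 : ℝ) ≤ twoStepLaw.N (4993 / 5000)) :
    (lowerStep n / 10 ^ 5 : ℝ) ≤ twoStepLaw.N (4993 / 5000) := by
  have ht : (4993 / 5000 : ℝ) ∈ Icc (0 : ℝ) 1 := by norm_num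
  set k := numerator n / (25000 * 10 ^ 30) + 1
  have hk : twoStepLaw.F (4993 / 5000) (twoStepLaw.N (4993 / 5000)) ≤ k / 10 ^ 5 := by
    refine (twoStepLaw.F_anti ht.1 (by positivity) hn).trans ((F_le_numerator n).trans ?_)
    gcongr
    have := Nat.lt_div_mul_add (a := numerator n) (b := 25000 * 10 ^ 30) (by norm_num)
    rw [div_le_iff₀ (by norm_num)]
    have h2 : numerator n ≤ k * (25000 * 10 ^ 30) := by
      simp only [k, add_mul, one_mul]
      exact this.le
    exact_mod_cast h2
  rcases le_total (k * 10 ^ 30 + k ^ 2 * 10 ^ 25 + 3 * k ^ 7) (5 * 10 ^ 35) with hk' | hk'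
  · rw [← twoStepLaw.FF_N ht]
    refine le_trans ?_ (twoStepLaw.F_anti ht.1 (twoStepLaw.F_mem ht (twoStepLaw.N_mem _)).1 hk)
    rw [F_eq_numerator hk']
    gcongr
    exact_mod_cast Nat.cast_div_le (α := ℝ) (m := numerator k) (n := 25000 * 10 ^ 30)
  · have : lowerStep n = 0 := by
      change numerator k / (25000 * 10 ^ 30) = 0
      rw [numerator, Nat.sub_eq_zero_of_le hk', mul_zero, Nat.zero_div]
    rw [this]
    simpa using (twoStepLaw.N_mem (4993 / 5000)).1

lemma lowerStep_iterate : 60500 < lowerStep^[130] 0 := by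
  decide +kernel

/-- Just beyond the degenerate cycle, the outermost cycle is still close to it: iterating from `0`
passes through the bottleneck. -/
lemma lt_twoStepLaw_N : 121 / 200 < twoStepLaw.N (4993 / 5000) := by
  have h : ∀ k, ((lowerStep^[k] 0 : ℕ) / 10 ^ 5 : ℝ) ≤ twoStepLaw.N (4993 / 5000) := by
    intro k
    induction k with
    | zero => simpa using (twoStepLaw.N_mem (4993 / 5000)).1
    | succ k ih =>
      rw [Function.iterate_succ_apply']
      exact lowerStep_le ih
  refine lt_of_lt_of_le ?_ (h 130)
  rw [lt_div_iff₀ (by norm_num)]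
  have : (60500 : ℝ) < (lowerStep^[130] 0 : ℕ) := by exact_mod_cast lowerStep_iterate
  linarith

lemma twoStepLaw_transitions :
    ∃ t₁ t₂ : ℝ, 0 < t₁ ∧ t₁ < t₂ ∧ t₂ < 1 ∧ (∀ t ∈ Ioc 0 t₁, twoStepLaw.D t = 0) ∧
      ContinuousOn twoStepLaw.D (Ioo 0 t₂) ∧ StrictMonoOn twoStepLaw.D (Ico t₁ t₂) ∧
      ∃ a b : ℝ, 0 < a ∧ a < b ∧ b < 1 ∧ Tendsto twoStepLaw.D (𝓝[<] t₂) (𝓝 a) ∧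
        Tendsto twoStepLaw.D (𝓝[>] t₂) (𝓝 b) ∧ twoStepLaw.D t₂ = b := by
  -- The degenerate cycle lies near `u`, at a parameter below `lo`; at `hi` there is a distant cycle
  -- with smaller point at most `z`. On the box `[u₁, u₀] × [0, v₀]`, which contains all cycles with
  -- smaller point at least `x₁`, the value `lam = 7 / 8` separates the quotients `Ψ_v / Φ_v` and
  -- `Ψ_u / Φ_u` of partial derivatives.
  refine twoStepLaw.continuous_then_jump (x₁ := 121 / 200) (z := 9 / 100) (lo := 4993 / 5000)
    (hi := 9999 / 10000) (u := 70579 / 100000) (cycles_strictAnti (lam := 7 / 8)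
      (y₁ := 7881 / 10000) (u₁ := 87 / 125) (u₀ := 353 / 500) (v₀ := 21 / 2500)
      (fun v hv => twoStepLaw_mono_midpoint hv) (fun u hu => twoStepLaw_anti_distance hu)
      ?_ ?_ ?_ ?_ ?_ ?_ ?_) ?_ ?_ ?_ ?_ ?_ ?_ lt_twoStepLaw_N ?_ ?_ ?_ ?_ <;>
  norm_num [F, Q, Φ, Ψ, Φm, twoStepLaw]

end Trinomial

/-! ### The escape game -/

namespace Escape

/-- The law with weights `3/4` at `1` and `1/4` at `3`. -/
def weights : Weights where
  w k := if k = 1 then 3 / 4 else if k = 3 then 1 / 4 else 0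
  K := 3
  nonneg k := by split_ifs <;> norm_num
  eq_zero k hk := by simp [show k ≠ 1 by omega, show k ≠ 3 by omega]
  sum_eq_one := by norm_num [Finset.sum_range_succ]

/-- The probability that Escaper wins when moving first, as a function of the parameter. -/
def E (t : ℝ) : ℝ := probE1 (weights.law t)

/-- If `y` is the probability that Stopper cannot win when Escaper moves first, then this is the
probability that Stopper cannot win when moving first. -/
def Z (t y : ℝ) : ℝ := t * y * (3 + y ^ 2) / 4

/-- The recursion for the escape game is `y = y * φ t y`. -/
def φ (t y : ℝ) : ℝ := t ^ 2 * (3 + y ^ 2) * (6 - 3 * Z t y + Z t y ^ 2) / 16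

variable {t : ℝ}

lemma recursion (ht : t ∈ Icc (0 : ℝ) 1) (y : ℝ) :
    1 - pgf (weights.law t) ((weights.law t 0).toReal + 1 - pgf (weights.law t) y) =
      y * φ t y := by
  rw [Weights.pgf_law _ ht, Weights.pgf_law _ ht, Weights.law_toReal_of_mem _ ht]
  simp only [weights, Weights.mix, Finset.sum_range_succ, Finset.sum_range_zero, φ, Z]
  norm_num
  ring

lemma E_mem (t : ℝ) : E t ∈ Icc (0 : ℝ) 1 := probE1_mem _

lemma E_eq (ht : t ∈ Icc (0 : ℝ) 1) : E t * φ t (E t) = E t := by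
  rw [← recursion ht, E, ← probE1_eq]

lemma le_E (ht : t ∈ Icc (0 : ℝ) 1) {y : ℝ} (hy : y ∈ Icc (0 : ℝ) 1) (h : 1 ≤ φ t y) :
    y ≤ E t :=
  le_probE1 _ hy (by rw [recursion ht]; exact le_mul_of_one_le_right hy.1 h)

lemma continuous_φ : Continuous fun z : ℝ × ℝ => φ z.1 z.2 := by unfold φ Z; fun_prop

/-- The complementarity conditions that characterise the largest solution of the recursion. -/
structure IsSolution (t y : ℝ) : Prop where
  φ_le : φ t y ≤ 1
  mul_eq : y * φ t y = y

lemma isSolution_E (ht : t ∈ Icc (0 : ℝ) 1) : IsSolution t (E t) := by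
  refine ⟨not_lt.1 fun h => ?_, E_eq ht⟩
  have h0 : E t = 0 := by
    have := E_eq ht
    by_contra hne
    have h1 : φ t (E t) = 1 := mul_left_cancel₀ hne (by rw [this, mul_one])
    linarith
  rw [h0] at h
  have hc : ContinuousAt (fun y => φ t y) 0 :=
    (continuous_φ.comp (continuous_const.prodMk continuous_id)).continuousAt
  have hev : ∀ᶠ y in 𝓝[>] (0 : ℝ), 1 < φ t y ∧ y ∈ Ioo (0 : ℝ) 1 :=
    (Filter.Eventually.filter_mono nhdsWithin_le_nhds (hc.eventually_const_lt h)).and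
      (Ioo_mem_nhdsGT one_pos)
  obtain ⟨y, hy, hy01⟩ := hev.exists
  linarith [le_E ht (Ioo_subset_Icc_self hy01) hy.le, hy01.1]

/-- With `c = 16 / t ^ 2`, every positive solution `y` of the recursion for the escape game gives a
solution `z = Z t y` of `P c z = c ^ 2`. -/
def P (c z : ℝ) : ℝ :=
  3 * c * (6 - 3 * z + z ^ 2) + z ^ 2 * (6 - 3 * z + z ^ 2) ^ 3

lemma convexOn_P {c : ℝ} (hc : 16 ≤ c) : ConvexOn ℝ (Icc 0 1) (P c) := by
  have hP : P c = fun z => 18 * c - 9 * c * z + (3 * c + 216) * z ^ 2 - 324 * z ^ 3 + 270 * z ^ 4 -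
      135 * z ^ 5 + 45 * z ^ 6 - 9 * z ^ 7 + z ^ 8 := by
    ext z
    unfold P
    ring
  have hP' : ∀ z, HasDerivAt (P c) (-9 * c + (3 * c + 216) * (2 * z) - 972 * z ^ 2 + 1080 * z ^ 3 -
      675 * z ^ 4 + 270 * z ^ 5 - 63 * z ^ 6 + 8 * z ^ 7) z := by
    intro z
    rw [hP]
    refine HasDerivAt.congr_deriv (((((((((hasDerivAt_const z (18 * c)).sub
      ((hasDerivAt_id z).const_mul (9 * c))).add ((hasDerivAt_pow 2 z).const_mul (3 * c + 216))).sub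
      ((hasDerivAt_pow 3 z).const_mul 324)).add ((hasDerivAt_pow 4 z).const_mul 270)).sub
      ((hasDerivAt_pow 5 z).const_mul 135)).add ((hasDerivAt_pow 6 z).const_mul 45)).sub
      ((hasDerivAt_pow 7 z).const_mul 9)).add (hasDerivAt_pow 8 z)) ?_
    push_cast
    ring
  have hP'' : ∀ z : ℝ, HasDerivAt (fun z => -9 * c + (3 * c + 216) * (2 * z) - 972 * z ^ 2 +
      1080 * z ^ 3 - 675 * z ^ 4 + 270 * z ^ 5 - 63 * z ^ 6 + 8 * z ^ 7)
      (2 * (3 * c + 216) - 1944 * z + 3240 * z ^ 2 - 2700 * z ^ 3 + 1350 * z ^ 4 - 378 * z ^ 5 +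
        56 * z ^ 6) z := by
    intro z
    refine HasDerivAt.congr_deriv ((((((((hasDerivAt_const z (-9 * c)).add
      (((hasDerivAt_id z).const_mul 2).const_mul (3 * c + 216))).sub
      ((hasDerivAt_pow 2 z).const_mul 972)).add ((hasDerivAt_pow 3 z).const_mul 1080)).sub
      ((hasDerivAt_pow 4 z).const_mul 675)).add ((hasDerivAt_pow 5 z).const_mul 270)).sub
      ((hasDerivAt_pow 6 z).const_mul 63)).add ((hasDerivAt_pow 7 z).const_mul 8)) ?_
    push_cast
    ring
  refine convexOn_of_hasDerivWithinAt2_nonneg (convex_Icc 0 1)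
    (fun z _ => (hP' z).continuousAt.continuousWithinAt) (fun z _ => (hP' z).hasDerivWithinAt)
    (fun z _ => (hP'' z).hasDerivWithinAt) fun z hz => ?_
  rw [interior_Icc] at hz
  have h4 : z ^ 5 ≤ z ^ 4 := pow_le_pow_of_le_one hz.1.le hz.2.le (by norm_num)
  have h6 : 0 ≤ z ^ 6 := by positivity
  -- The remaining quartic is a sum of squares.
  linarith [sq_nonneg (z ^ 2 - 25 / 18 * z + 1 / 2), sq_nonneg (z - 3 / 4), hz.1, hz.2]

lemma Z_lt {x y : ℝ} (ht : 0 < t) (hx : 0 ≤ x) (hxy : x < y) : Z t x < Z t y := by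
  unfold Z
  gcongr

lemma Z_mem (ht : t ∈ Ioo (0 : ℝ) 1) {y : ℝ} (hy : y ∈ Icc (0 : ℝ) 1) :
    Z t y ∈ Ico (0 : ℝ) 1 := by
  have h1 : y * (3 + y ^ 2) ≤ 4 := by nlinarith [hy.1, hy.2, pow_le_one₀ hy.1 hy.2 (n := 2)]
  have h0 : 0 ≤ y * (3 + y ^ 2) := mul_nonneg hy.1 (by positivity)
  unfold Z
  constructor
  · have := mul_nonneg ht.1.le h0
    linarith
  · nlinarith [ht.1, ht.2]

lemma IsSolution.P_le {y : ℝ} (h : IsSolution t y) (ht : t ∈ Ioo (0 : ℝ) 1) :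
    P (16 / t ^ 2) (Z t y) ≤ (16 / t ^ 2) ^ 2 ∧
      (y ≠ 0 → P (16 / t ^ 2) (Z t y) = (16 / t ^ 2) ^ 2) := by
  have ht2 : 0 < t ^ 2 := pow_pos ht.1 2
  have hpos : y ≠ 0 → P (16 / t ^ 2) (Z t y) = (16 / t ^ 2) ^ 2 := by
    intro hne
    have hφ : φ t y = 1 := mul_left_cancel₀ hne (by rw [h.mul_eq, mul_one])
    unfold φ at hφ
    set w := 6 - 3 * Z t y + Z t y ^ 2 with hw
    have h1 : (3 + y ^ 2) * w = 16 / t ^ 2 := by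
      rw [eq_div_iff ht2.ne']
      linear_combination 16 * hφ
    have h2 : Z t y ^ 2 * (16 / t ^ 2) = (y * (3 + y ^ 2)) ^ 2 := by
      have ht0 := ht.1.ne'
      unfold Z
      field_simp
      ring
    set c := 16 / t ^ 2
    have hc : c ≠ 0 := (by positivity : 0 < c).ne'
    have h3 : P c (Z t y) = 3 * c * w + Z t y ^ 2 * w ^ 3 := rfl
    refine mul_left_cancel₀ hc ?_
    rw [h3]
    linear_combination w ^ 3 * h2 + (y ^ 2 * w * ((3 + y ^ 2) * w + c) + c ^ 2) * h1
  refine ⟨?_, hpos⟩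
  rcases eq_or_ne y 0 with rfl | hne
  · have h1 := h.φ_le
    have h2 : Z t 0 = 0 := by simp [Z]
    have h3 : 18 ≤ 16 / t ^ 2 := by
      rw [le_div_iff₀ ht2]
      unfold φ at h1
      rw [h2] at h1
      linarith
    rw [h2]
    unfold P
    nlinarith
  · exact (hpos hne).le

/-- Two solutions, together with the strict inequality at `z = 1`, would contradict convexity. -/
lemma IsSolution.unique {x y : ℝ} (ht : t ∈ Ioo (0 : ℝ) 1) (hx : IsSolution t x)
    (hy : IsSolution t y) (hx1 : x ∈ Icc (0 : ℝ) 1) (hy1 : y ∈ Icc (0 : ℝ) 1) : x = y := by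
  wlog hxy : x < y generalizing x y
  · rcases lt_trichotomy x y with h | h | h
    · exact this hx hy hx1 hy1 h
    · exact h
    · exact (this hy hx hy1 hx1 h).symm
  exfalso
  have h1 := (hx.P_le ht).1
  have h2 := (hy.P_le ht).2 (hx1.1.trans_lt hxy).ne'
  have hzx := Z_mem ht hx1
  have hzy := Z_mem ht hy1
  have hz := Z_lt ht.1 hx1.1 hxy
  have hc : 16 < 16 / t ^ 2 := by
    rw [lt_div_iff₀ (pow_pos ht.1 2)]
    nlinarith [ht.1, ht.2]
  have hP1 : P (16 / t ^ 2) 1 < (16 / t ^ 2) ^ 2 := by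
    unfold P
    nlinarith
  obtain ⟨α, β, hα, hβ, hαβ, hcomb⟩ : ∃ α β : ℝ, 0 ≤ α ∧ 0 < β ∧ α + β = 1 ∧
      α * Z t x + β * 1 = Z t y := by
    have hd : 0 < 1 - Z t x := by linarith [hzx.2]
    refine ⟨(1 - Z t y) / (1 - Z t x), (Z t y - Z t x) / (1 - Z t x),
      div_nonneg (by linarith [hzy.2]) hd.le, div_pos (by linarith) hd, ?_, ?_⟩
    · field_simp
      ring
    · field_simp
      ring
  have hconv := (convexOn_P hc.le).2 (Ico_subset_Icc_self hzx) (right_mem_Icc.2 zero_le_one)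
    hα hβ.le hαβ
  simp only [smul_eq_mul] at hconv
  rw [hcomb, h2] at hconv
  have h3 := mul_le_mul_of_nonneg_left h1 hα
  have h4 := mul_lt_mul_of_pos_left hP1 hβ
  have h5 : α * (16 / t ^ 2) ^ 2 + β * (16 / t ^ 2) ^ 2 = (16 / t ^ 2) ^ 2 := by
    rw [← add_mul, hαβ, one_mul]
  linarith

lemma isSolution_zero_iff : IsSolution t 0 ↔ t ^ 2 ≤ 8 / 9 := by
  have h : φ t 0 = 9 / 8 * t ^ 2 := by
    unfold φ Z
    ring
  refine ⟨fun hs => ?_, fun ht => ⟨?_, zero_mul _⟩⟩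
  · have := hs.φ_le
    rw [h] at this
    linarith
  · rw [h]
    linarith

lemma E_lt_one (ht : t ∈ Ioo (0 : ℝ) 1) : E t < 1 := by
  have h := E_eq (Ioo_subset_Icc_self ht)
  have hz := Z_mem ht (E_mem t)
  have h1 : E t * φ t (E t) =
      t * (Z t (E t) * (6 - 3 * Z t (E t) + Z t (E t) ^ 2) / 4) := by
    have h3 : 4 * Z t (E t) = t * E t * (3 + E t ^ 2) := by
      unfold Z
      ring
    unfold φ
    linear_combination (-t / 16) * (6 - 3 * Z t (E t) + Z t (E t) ^ 2) * h3
  have h2 : Z t (E t) * (6 - 3 * Z t (E t) + Z t (E t) ^ 2) / 4 ≤ 1 := by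
    nlinarith [mul_nonneg (sub_nonneg.2 hz.2.le)
      (show 0 ≤ 4 - 2 * Z t (E t) + Z t (E t) ^ 2 by nlinarith [sq_nonneg (Z t (E t) - 1)])]
  rw [← h, h1]
  exact (mul_le_of_le_one_right ht.1.le h2).trans_lt ht.2

lemma IsSolution.of_tendsto {l : Filter ℝ} [l.NeBot] {f : ℝ → ℝ} {y : ℝ} (hl : l ≤ 𝓝 t)
    (h : ∀ᶠ s in l, IsSolution s (f s)) (hf : Tendsto f l (𝓝 y)) : IsSolution t y := by
  have hφ : Tendsto (fun s => φ s (f s)) l (𝓝 (φ t y)) :=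
    Tendsto.comp (g := fun z : ℝ × ℝ => φ z.1 z.2) (f := fun s => (s, f s))
      (continuous_φ.tendsto (t, y)) ((tendsto_id'.2 hl).prodMk_nhds hf)
  exact ⟨le_of_tendsto hφ (h.mono fun s hs => hs.φ_le),
    tendsto_nhds_unique_of_eventuallyEq (hf.mul hφ) hf (h.mono fun s hs => hs.mul_eq)⟩

lemma continuousOn_E : ContinuousOn E (Ioo 0 1) := by
  intro t ht
  refine ContinuousAt.continuousWithinAt ?_
  refine isCompact_Icc.tendsto_nhds_of_unique_mapClusterPt
    (Eventually.of_forall fun s => E_mem s) fun y hy hcl => ?_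
  obtain ⟨U, hU, hUy⟩ := mapClusterPt_iff_ultrafilter.1 hcl
  have hev : ∀ᶠ s in (U : Filter ℝ), IsSolution s (E s) :=
    Filter.Eventually.filter_mono hU
      (Filter.mem_of_superset (Icc_mem_nhds ht.1 ht.2) fun s hs => isSolution_E hs)
  exact (IsSolution.of_tendsto hU hev hUy).unique ht
    (isSolution_E (Ioo_subset_Icc_self ht)) hy (E_mem t)

lemma transition : ∃ t₀ ∈ Ioo (0 : ℝ) 1, (∀ t ∈ Ioo (0 : ℝ) 1, t ≤ t₀ → E t = 0) ∧
    (∀ t ∈ Ioo (0 : ℝ) 1, t₀ < t → E t ∈ Ioo (0 : ℝ) 1) ∧ ContinuousOn E (Ioo 0 1) := by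
  refine ⟨√(8 / 9), ⟨by positivity, ?_⟩, fun t ht hle => ?_, fun t ht hlt => ⟨?_, E_lt_one ht⟩,
    continuousOn_E⟩
  · rw [Real.sqrt_lt' one_pos]
    norm_num
  · have := (Real.le_sqrt ht.1.le (by norm_num)).1 hle
    exact IsSolution.unique ht (isSolution_E (Ioo_subset_Icc_self ht))
      (isSolution_zero_iff.2 this) (E_mem t) (by simp)
  · refine (E_mem t).1.lt_of_ne fun h => ?_
    have hs := isSolution_E (Ioo_subset_Icc_self ht)
    rw [← h, isSolution_zero_iff] at hs
    exact hlt.not_ge (Real.le_sqrt_of_sq_le hs)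

end Escape

end GWGame

end

theorem proposition4 :
    -- (i) the normal game has a discontinuous phase transition
    (∃ p : ℝ → PMF ℕ, GWGame.ContinuousFamily p ∧ GWGame.UniformlyBoundedSupport p ∧
      ∃ t₀ ∈ Ioo (0 : ℝ) 1,
        (∀ t ∈ Ioo (0 : ℝ) 1, t < t₀ → GWGame.probD (p t) = 0) ∧
        (∀ t ∈ Ioo (0 : ℝ) 1, t₀ ≤ t → GWGame.probD (p t) ∈ Ioo (0 : ℝ) 1) ∧
        p t₀ 1 < 1) ∧
    -- (ii) the normal game has a continuous transition and then a jump between positive values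
    (∃ p : ℝ → PMF ℕ, GWGame.ContinuousFamily p ∧ GWGame.UniformlyBoundedSupport p ∧
      ∃ t₁ t₂ : ℝ, 0 < t₁ ∧ t₁ < t₂ ∧ t₂ < 1 ∧
        (∀ t ∈ Ioc 0 t₁, GWGame.probD (p t) = 0) ∧
        ContinuousOn (fun t => GWGame.probD (p t)) (Ioo 0 t₂) ∧
        StrictMonoOn (fun t => GWGame.probD (p t)) (Ico t₁ t₂) ∧
        ∃ a b : ℝ, 0 < a ∧ a < b ∧ b < 1 ∧
          Tendsto (fun t => GWGame.probD (p t)) (𝓝[<] t₂) (𝓝 a) ∧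
          Tendsto (fun t => GWGame.probD (p t)) (𝓝[>] t₂) (𝓝 b) ∧
          GWGame.probD (p t₂) = b) ∧
    -- (iii) the escape game has a continuous phase transition
    (∃ p : ℝ → PMF ℕ, GWGame.ContinuousFamily p ∧ GWGame.UniformlyBoundedSupport p ∧
      ∃ t₀ ∈ Ioo (0 : ℝ) 1,
        (∀ t ∈ Ioo (0 : ℝ) 1, t ≤ t₀ → GWGame.probE1 (p t) = 0) ∧
        (∀ t ∈ Ioo (0 : ℝ) 1, t₀ < t → GWGame.probE1 (p t) ∈ Ioo (0 : ℝ) 1) ∧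
        ContinuousOn (fun t => GWGame.probE1 (p t)) (Ioo 0 1)) := by

  refine ⟨⟨_, GWGame.Weights.continuousFamily GWGame.Trinomial.jumpLaw.weights,
      GWGame.Weights.uniformlyBoundedSupport _, ?_⟩,
    ⟨_, GWGame.Weights.continuousFamily GWGame.Trinomial.twoStepLaw.weights,
      GWGame.Weights.uniformlyBoundedSupport _, GWGame.Trinomial.twoStepLaw_transitions⟩,
    ⟨_, GWGame.Weights.continuousFamily GWGame.Escape.weights,
      GWGame.Weights.uniformlyBoundedSupport _, GWGame.Escape.transition⟩⟩
  obtain ⟨t₀, ht₀, hlt, hge⟩ := GWGame.Trinomial.jumpLaw_transition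
  refine ⟨t₀, ht₀, hlt, hge, ?_⟩
  rw [← ENNReal.toReal_lt_toReal (PMF.apply_ne_top _ _) ENNReal.one_ne_top,
    GWGame.Weights.law_toReal_of_mem _ (Ioo_subset_Icc_self ht₀)]
  norm_num [GWGame.Weights.mix, GWGame.Trinomial.weights, GWGame.Trinomial.jumpLaw]
  linarith [ht₀.2]
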